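/- **Trees and operators.** Let $T$ be the set of finite rooted binary trees whose leaves are labelled by positive integers; write $t_1t_2$ for the tree with left subtree $t_1$ and right subtree $t_2$. An *address* is a finite word in $\{0,1\}$ ($0$ = left, $1$ = right); the empty address is omitted as an index. Let $A$ be the partial injection $t_1(t_2t_3)\mapsto (t_1t_2)t_3$ of $T$, let $C$ be the partial injection $t_1t_2\mapsto t_2t_1$, and, for an address $\alpha$, let $A_\alpha$, $C_\alpha$ be the result of applying $A$, $C$ to the subtree at $\alpha$ (when this is defined). Let $\mathcal G(\mathcal A,\mathcal C)$ be the monoid of partial injections generated by all $A_\alpha^{\pm1}, C_\alpha^{\pm1}$, where $fg$ means "$f$, then $g$". Call $f,g$ near-equal if there is a tree on which both are defined and they agree on every such tree. Near-equality is a congruence on $\mathcal G(\mathcal A,\mathcal C)$ and the quotient is a group $G(\mathcal A,\mathcal C)$, which is identified with Thompson's group $V$. In this group put $S_\alpha = C_\alpha A_\alpha^{-1}C_{\alpha1}^{-1}$ (it acts by $t_1(t_2t_3)\mapsto t_2(t_1t_3)$ on the subtree at $\alpha$), and let $\mathfrak S_\bullet$ be the subgroup generated by all the elements $A_\alpha$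 and $S_\alpha$. **Relations.** Let $R_{AS}$ be the family of all translated copies (i.e. a fixed address $\gamma$ is put in front of every index, for every address $\gamma$) of the following relations, where $\alpha,\beta$ range over all addresses and $X,Y$ over $\{A,S\}$: - $X_{0\alpha}Y_{1\beta}=Y_{1\beta}X_{0\alpha}$; - $X_{11\alpha}A=AX_{1\alpha}$, $\quad X_{10\alpha}A=AX_{01\alpha}$, $\quad X_{0\alpha}A=AX_{00\alpha}$; - $X_{11\alpha}S=SX_{11\alpha}$, $\quad X_{10\alpha}S=SX_{0\alpha}$, $\quad X_{0\alpha}S=SX_{10\alpha}$; - $AA=A_1AA_0$; - $SA_1A=A_1AS_0$, $\quad S_1SA_1=AS$, $\quad SS_1A=A_1S$, $\quad SS_1S=S_1SS_1$. **Proposition 4.4.** The relations $R_{AS}$, completed with the torsion relations $S_\alpha^2=1$ for all addresses $\alpha$, make a presentation of $\mathfrak S_\bullet$ in terms of the generators $A_\alpha$ and $S_\alpha$. That is, the group with formal generators $A_\alpha,S_\alpha$ (for all addresses $\alpha$) and these relations is isomorphic to $\mathfrak S_\bullet$, by an isomorphism that maps each formal generator to the element of $\mathfrak S_\bullet$ with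 the same name. -/

import Mathlib

/-! Geometry group of associativity and commutativity, built from partial operators on coloured
binary trees, the subgroup generated by the associativity and semi-commutativity elements, and the
family of relations between these elements. -/

namespace TreeGeometry

/-- Finite rooted binary trees whose leaves wear labels in the positive integers:
`FreeMagma.of x` is the one-vertex tree with label `x`, and `t₁ * t₂` is the tree with left
subtree `t₁` and right subtree `t₂`. -/
abbrev CTree : Type := FreeMagma ℕ+

/-- Partial injections of the set of coloured trees into itself. -/
abbrev POp : Type := CTree ≃. CTree

/-- Addresses: finite sequences of `0` (`false`, fork to the left) and `1` (`true`, fork to the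
right). -/
abbrev Address : Type := List Bool

/-- Partial injections with reversed composition: `f * g` is "`f`, then `g`". -/
instance instMonoidPOp : Monoid POp where
  mul f g := f.trans g
  one := PEquiv.refl CTree
  mul_assoc f g h := PEquiv.trans_assoc f g h
  one_mul f := PEquiv.refl_trans f
  mul_one f := PEquiv.trans_refl f

theorem mul_def (f g : POp) : f * g = f.trans g := rfl

theorem one_def : (1 : POp) = PEquiv.refl CTree := rfl

/-- `t₁(t₂t₃) ↦ (t₁t₂)t₃`, undefined on other trees. -/
def assocFun : CTree → Option CTree
  | .mul a (.mul b c) => some ((a * b) * c)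
  | _ => none

/-- `(t₁t₂)t₃ ↦ t₁(t₂t₃)`, undefined on other trees. -/
def assocInvFun : CTree → Option CTree
  | .mul (.mul a b) c => some (a * (b * c))
  | _ => none

/-- The associativity operator `A`. -/
def opA : POp where
  toFun := assocFun
  invFun := assocInvFun
  inv a b := by
    constructor
    · intro h
      rcases b with _ | ⟨_ | ⟨b1, b2⟩, b3⟩ <;> simp [assocInvFun] at h
      subst h; rfl
    · intro h
      rcases a with _ | ⟨a1, _ | ⟨a2, a3⟩⟩ <;> simp [assocFun] at h
      subst h; rfl

/-- `t₁t₂ ↦ t₂t₁`, undefined on one-vertex trees. -/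
def commFun : CTree → Option CTree
  | .mul a b => some (b * a)
  | _ => none

/-- The commutativity operator `C`. -/
def opC : POp where
  toFun := commFun
  invFun := commFun
  inv a b := by
    constructor
    · intro h
      rcases b with _ | ⟨b1, b2⟩ <;> simp [commFun] at h
      subst h; rfl
    · intro h
      rcases a with _ | ⟨a1, a2⟩ <;> simp [commFun] at h
      subst h; rfl

/-- Apply a partial map to the left subtree. -/
def onLeft (f : CTree → Option CTree) : CTree → Option CTree
  | .mul a b => (f a).map (fun a' => a' * b)
  | _ => none

/-- Apply a partial map to the right subtree. -/
def onRight (f : CTree → Option CTree) : CTree → Option CTree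
  | .mul a b => (f b).map (fun b' => a * b')
  | _ => none

theorem mem_onLeft {f : CTree → Option CTree} {t t' : CTree} :
    t' ∈ onLeft f t ↔ ∃ a b a', t = a * b ∧ a' ∈ f a ∧ t' = a' * b := by
  constructor
  · intro h
    rcases t with _ | ⟨a, b⟩
    · simp [onLeft] at h
    · simp only [onLeft, Option.mem_def, Option.map_eq_some_iff] at h
      obtain ⟨a', h1, h2⟩ := h
      exact ⟨a, b, a', rfl, h1, h2.symm⟩
  · rintro ⟨a, b, a', rfl, h, rfl⟩
    exact Option.map_eq_some_iff.2 ⟨a', h, rfl⟩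

theorem mem_onRight {f : CTree → Option CTree} {t t' : CTree} :
    t' ∈ onRight f t ↔ ∃ a b b', t = a * b ∧ b' ∈ f b ∧ t' = a * b' := by
  constructor
  · intro h
    rcases t with _ | ⟨a, b⟩
    · simp [onRight] at h
    · simp only [onRight, Option.mem_def, Option.map_eq_some_iff] at h
      obtain ⟨b', h1, h2⟩ := h
      exact ⟨a, b, b', rfl, h1, h2.symm⟩
  · rintro ⟨a, b, b', rfl, h, rfl⟩
    exact Option.map_eq_some_iff.2 ⟨b', h, rfl⟩

/-- The shift `∂_0 f`. -/
def shiftLeft (f : POp) : POp where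
  toFun := onLeft f
  invFun := onLeft f.symm
  inv a b := by
    change a ∈ onLeft f.symm b ↔ b ∈ onLeft f a
    rw [mem_onLeft, mem_onLeft]
    constructor
    · rintro ⟨x, y, x', rfl, h, rfl⟩
      exact ⟨x', y, x, rfl, (PEquiv.mem_iff_mem f).1 h, rfl⟩
    · rintro ⟨x, y, x', rfl, h, rfl⟩
      exact ⟨x', y, x, rfl, (PEquiv.mem_iff_mem f).2 h, rfl⟩

/-- The shift `∂_1 f`. -/
def shiftRight (f : POp) : POp where
  toFun := onRight f
  invFun := onRight f.symm
  inv a b := by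
    change a ∈ onRight f.symm b ↔ b ∈ onRight f a
    rw [mem_onRight, mem_onRight]
    constructor
    · rintro ⟨x, y, y', rfl, h, rfl⟩
      exact ⟨x, y', y, rfl, (PEquiv.mem_iff_mem f).1 h, rfl⟩
    · rintro ⟨x, y, y', rfl, h, rfl⟩
      exact ⟨x, y', y, rfl, (PEquiv.mem_iff_mem f).2 h, rfl⟩

/-- The `α`-shift `∂_α f`: apply `f` to the `α`-subtree (when the latter exists). -/
def shift : Address → POp → POp
  | [], f => f
  | false :: α, f => shiftLeft (shift α f)
  | true :: α, f => shiftRight (shift α f)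

/-- The operators `A_α`, `C_α` and their inverses. -/
def operators : Set POp :=
  {f | ∃ α : Address, f = shift α opA ∨ f = (shift α opA).symm ∨
    f = shift α opC ∨ f = (shift α opC).symm}

/-- The geometry monoid of associativity and commutativity. -/
def geometryMonoid : Submonoid POp := Submonoid.closure operators

/-- Near-equality: there is a tree on which both partial maps are defined, and they agree on
every such tree. -/
def NearEq (f g : POp) : Prop :=
  (∃ t a b, f t = some a ∧ g t = some b) ∧
    ∀ t a b, f t = some a → g t = some b → a = b

/-! Auxiliary facts, used only to check that near-equality is a congruence on the geometry monoid
and that the quotient is a group. -/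

/-- Minimal depth of a leaf. -/
def depth : CTree → ℕ
  | .of _ => 0
  | .mul a b => min (depth a) (depth b) + 1

/-- Follow an infinite path from the root down to a leaf: label of the leaf and rest of the path. -/
def leafAt : CTree → Stream' Bool → ℕ+ × Stream' Bool
  | .of n, x => (n, x)
  | .mul a b, x => bif x.head then leafAt b x.tail else leafAt a x.tail

/-- An infinite path starts with `0` or with `1`. -/
def pathEquiv : Stream' Bool ⊕ Stream' Bool ≃ Stream' Bool where
  toFun := Sum.elim (Stream'.cons false) (Stream'.cons true)
  invFun x := bif x.head then Sum.inr x.tail else Sum.inl x.tail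
  left_inv x := by rcases x with x | x <;> rfl
  right_inv x := by
    change Sum.elim (Stream'.cons false) (Stream'.cons true)
      (bif x.head then Sum.inr x.tail else Sum.inl x.tail) = x
    cases h : x.head with
    | false => rw [cond_false, Sum.elim_inl, ← h]; exact Stream'.eta x
    | true => rw [cond_true, Sum.elim_inr, ← h]; exact Stream'.eta x

theorem leafAt_inl (a b : CTree) (x : Stream' Bool) :
    leafAt (a * b) (pathEquiv (Sum.inl x)) = leafAt a x := rfl

theorem leafAt_inr (a b : CTree) (x : Stream' Bool) :
    leafAt (a * b) (pathEquiv (Sum.inr x)) = leafAt b x := rfl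

theorem depth_mul (a b : CTree) : depth (a * b) = min (depth a) (depth b) + 1 := rfl

/-- `f` moves the leaves as the permutation `p` of infinite paths does. -/
def Compat (f : POp) (p : Equiv.Perm (Stream' Bool)) : Prop :=
  ∀ t t', f t = some t' → ∀ x, leafAt t x = leafAt t' (p x)

/-- `f` is defined on every sufficiently deep tree. -/
def Wide (f : POp) : Prop :=
  ∃ n, ∀ m t, n + m ≤ depth t → ∃ t', f t = some t' ∧ m ≤ depth t'

theorem exists_mul_of_depth {t : CTree} {n : ℕ} (h : n + 1 ≤ depth t) :
    ∃ a b, t = a * b ∧ n ≤ depth a ∧ n ≤ depth b := by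
  rcases t with _ | ⟨a, b⟩
  · simp [depth] at h
  · simp only [depth] at h
    exact ⟨a, b, rfl, by omega, by omega⟩

theorem exists_deep (n : ℕ) : ∃ t : CTree, n ≤ depth t ∧ Function.Injective (leafAt t) := by
  induction n with
  | zero =>
    refine ⟨.of 1, Nat.zero_le _, fun x y h => ?_⟩
    simpa [leafAt] using h
  | succ n ih =>
    obtain ⟨t, h1, h2⟩ := ih
    have hm : ∀ (f : ℕ+ → ℕ+) (s : CTree), depth (FreeMagma.map f s) = depth s ∧
        ∀ x, leafAt (FreeMagma.map f s) x = (f (leafAt s x).1, (leafAt s x).2) := by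
      intro f s
      induction s with
      | of n => exact ⟨rfl, fun _ => rfl⟩
      | mul a b iha ihb =>
        change depth (FreeMagma.map f (a * b)) = depth (a * b) ∧
          ∀ x, leafAt (FreeMagma.map f (a * b)) x =
            (f (leafAt (a * b) x).1, (leafAt (a * b) x).2)
        rw [map_mul]
        refine ⟨by rw [depth_mul, depth_mul, iha.1, ihb.1], fun x => ?_⟩
        obtain ⟨x | x, rfl⟩ := pathEquiv.surjective x
        · rw [leafAt_inl, leafAt_inl, iha.2]
        · rw [leafAt_inr, leafAt_inr, ihb.2]
    have inj : ∀ f : ℕ+ → ℕ+, Function.Injective f →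
        Function.Injective (leafAt (FreeMagma.map f t)) := by
      intro f hf x y h
      rw [(hm f t).2, (hm f t).2, Prod.mk.injEq] at h
      exact h2 (Prod.ext (hf h.1) h.2)
    have i1 : Function.Injective (fun k : ℕ+ => 2 * k) := fun a b h => by
      have : 2 * (a : ℕ) = 2 * b := by exact_mod_cast congrArg PNat.val h
      exact PNat.eq (by omega)
    have i2 : Function.Injective (fun k : ℕ+ => 2 * k + 1) := fun a b h => by
      have : 2 * (a : ℕ) + 1 = 2 * b + 1 := by exact_mod_cast congrArg PNat.val h
      exact PNat.eq (by omega)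
    have ne : ∀ a b : ℕ+, 2 * a ≠ 2 * b + 1 := fun a b h => by
      have : 2 * (a : ℕ) = 2 * b + 1 := by exact_mod_cast congrArg PNat.val h
      omega
    refine ⟨FreeMagma.map (fun k => 2 * k) t * FreeMagma.map (fun k => 2 * k + 1) t, ?_, ?_⟩
    · rw [depth_mul, (hm _ t).1, (hm _ t).1]; omega
    · intro x y h
      obtain ⟨x | x, rfl⟩ := pathEquiv.surjective x <;>
        obtain ⟨y | y, rfl⟩ := pathEquiv.surjective y <;>
        simp only [leafAt_inl, leafAt_inr] at h
      · rw [inj _ i1 h]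
      · rw [(hm _ t).2, (hm _ t).2, Prod.mk.injEq] at h
        exact absurd h.1 (ne _ _)
      · rw [(hm _ t).2, (hm _ t).2, Prod.mk.injEq] at h
        exact absurd h.1.symm (ne _ _)
      · rw [inj _ i2 h]

theorem leafAt_injective : ∀ s t : CTree, leafAt s = leafAt t → s = t := by
  have drop : ∀ (t : CTree) (x : Stream' Bool), ∃ n, (leafAt t x).2 = x.drop n := by
    intro t
    induction t with
    | of n => exact fun x => ⟨0, rfl⟩
    | mul a b iha ihb =>
      intro x
      obtain ⟨x | x, rfl⟩ := pathEquiv.surjective x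
      · obtain ⟨n, hn⟩ := iha x
        exact ⟨n + 1, hn⟩
      · obtain ⟨n, hn⟩ := ihb x
        exact ⟨n + 1, hn⟩
  have key : ∀ (n : ℕ+) (a b : CTree), leafAt (.of n) ≠ leafAt (a * b) := by
    intro n a b h
    have h1 := congrFun h (pathEquiv (Sum.inr (Stream'.const false)))
    rw [leafAt_inr] at h1
    obtain ⟨k, hk⟩ := drop b (Stream'.const false)
    have h2 := congrArg Prod.snd h1
    rw [hk] at h2
    have h3 : (Stream'.cons true (Stream'.const false)).head =
        ((Stream'.const false).drop k).head := congrArg Stream'.head h2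
    have h4 : ((Stream'.const false).drop k).head = false := rfl
    rw [h4] at h3
    exact absurd h3 (by simp)
  intro s
  induction s with
  | of n =>
    intro t h
    rcases t with m | ⟨a, b⟩
    · have := congrArg Prod.fst (congrFun h (Stream'.const false))
      exact congrArg FreeMagma.of this
    · exact absurd h (key n a b)
  | mul a b iha ihb =>
    intro t h
    rcases t with m | ⟨c, d⟩
    · exact absurd h.symm (key m a b)
    · have e1 : a = c := iha c (funext fun x => congrFun h (pathEquiv (Sum.inl x)))
      have e2 : b = d := ihb d (funext fun x => congrFun h (pathEquiv (Sum.inr x)))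
      rw [e1, e2]

theorem Compat.symm {f : POp} {p : Equiv.Perm (Stream' Bool)} (h : Compat f p) :
    Compat f.symm p⁻¹ := by
  intro t t' ht x
  have := h t' t ((PEquiv.eq_some_iff f).1 ht) (p⁻¹ x)
  rw [this]; simp

theorem Compat.mul {f g : POp} {p q : Equiv.Perm (Stream' Bool)} (hf : Compat f p)
    (hg : Compat g q) : Compat (f * g) (q * p) := by
  intro t t' ht x
  obtain ⟨u, h1, h2⟩ := (PEquiv.trans_eq_some f g t t').1 ht
  rw [hf t u h1, hg u t' h2]; rfl

theorem Compat.one : Compat 1 1 := by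
  intro t t' h x
  have h' : some t = some t' := h
  rw [Option.some.inj h']; rfl

theorem Wide.one : Wide 1 := ⟨0, fun m t h => ⟨t, rfl, by omega⟩⟩

theorem Wide.mul {f g : POp} (hf : Wide f) (hg : Wide g) : Wide (f * g) := by
  obtain ⟨n, hn⟩ := hf
  obtain ⟨k, hk⟩ := hg
  refine ⟨n + k, fun m t h => ?_⟩
  obtain ⟨u, h1, h2⟩ := hn (k + m) t (by omega)
  obtain ⟨v, h3, h4⟩ := hk m u h2
  exact ⟨v, (PEquiv.trans_eq_some f g t v).2 ⟨u, h1, h3⟩, h4⟩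

theorem Wide.shiftLeft {f : POp} (hf : Wide f) : Wide (shiftLeft f) := by
  obtain ⟨n, hn⟩ := hf
  refine ⟨n + 1, fun m t h => ?_⟩
  obtain ⟨a, b, rfl, ha, hb⟩ := exists_mul_of_depth (t := t) (n := n + m) (by omega)
  obtain ⟨a', h1, h2⟩ := hn m a ha
  exact ⟨a' * b, mem_onLeft.2 ⟨a, b, a', rfl, h1, rfl⟩, by rw [depth_mul]; omega⟩

theorem Wide.shiftRight {f : POp} (hf : Wide f) : Wide (shiftRight f) := by
  obtain ⟨n, hn⟩ := hf
  refine ⟨n + 1, fun m t h => ?_⟩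
  obtain ⟨a, b, rfl, ha, hb⟩ := exists_mul_of_depth (t := t) (n := n + m) (by omega)
  obtain ⟨b', h1, h2⟩ := hn m b hb
  exact ⟨a * b', mem_onRight.2 ⟨a, b, b', rfl, h1, rfl⟩, by rw [depth_mul]; omega⟩

theorem Wide.shift {f : POp} (hf : Wide f) : ∀ α, Wide (shift α f)
  | [] => hf
  | false :: α => (Wide.shift hf α).shiftLeft
  | true :: α => (Wide.shift hf α).shiftRight

theorem shift_symm (f : POp) : ∀ α, (shift α f).symm = shift α f.symm
  | [] => rfl
  | false :: α => by
    have h : (shift (false :: α) f).symm = shiftLeft (shift α f).symm := rfl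
    rw [h, shift_symm f α]; rfl
  | true :: α => by
    have h : (shift (true :: α) f).symm = shiftRight (shift α f).symm := rfl
    rw [h, shift_symm f α]; rfl

theorem exists_compat_shift {f : POp} (hf : ∃ p, Compat f p) : ∀ α, ∃ p, Compat (shift α f) p
  | [] => hf
  | false :: α => by
    obtain ⟨p, hp⟩ := exists_compat_shift hf α
    refine ⟨pathEquiv.symm.trans ((Equiv.sumCongr p (Equiv.refl _)).trans pathEquiv), ?_⟩
    intro t t' h x
    obtain ⟨a, b, a', rfl, h1, rfl⟩ := mem_onLeft.1 h
    obtain ⟨x | x, rfl⟩ := pathEquiv.surjective x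
    · simpa [leafAt_inl] using hp a a' h1 x
    · simp [leafAt_inr]
  | true :: α => by
    obtain ⟨p, hp⟩ := exists_compat_shift hf α
    refine ⟨pathEquiv.symm.trans ((Equiv.sumCongr (Equiv.refl _) p).trans pathEquiv), ?_⟩
    intro t t' h x
    obtain ⟨a, b, b', rfl, h1, rfl⟩ := mem_onRight.1 h
    obtain ⟨x | x, rfl⟩ := pathEquiv.surjective x
    · simp [leafAt_inl]
    · simpa [leafAt_inr] using hp b b' h1 x

theorem exists_compat_opA : ∃ p, Compat opA p := by
  refine ⟨pathEquiv.symm.trans ((Equiv.sumCongr (Equiv.refl _) pathEquiv.symm).trans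
    ((Equiv.sumAssoc _ _ _).symm.trans ((Equiv.sumCongr pathEquiv (Equiv.refl _)).trans
      pathEquiv))), ?_⟩
  intro t t' h x
  rcases t with _ | ⟨a, _ | ⟨b, c⟩⟩
  · cases h
  · cases h
  · have h' : (a * b) * c = t' := Option.some.inj h
    subst h'
    change leafAt (a * (b * c)) x = _
    obtain ⟨x | x, rfl⟩ := pathEquiv.surjective x
    · simp [leafAt_inl]
    · obtain ⟨x | x, rfl⟩ := pathEquiv.surjective x <;> simp [leafAt_inl, leafAt_inr]

theorem exists_compat_opC : ∃ p, Compat opC p := by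
  refine ⟨pathEquiv.symm.trans ((Equiv.sumComm _ _).trans pathEquiv), ?_⟩
  intro t t' h x
  rcases t with _ | ⟨a, b⟩
  · cases h
  · have h' : b * a = t' := Option.some.inj h
    subst h'
    change leafAt (a * b) x = _
    obtain ⟨x | x, rfl⟩ := pathEquiv.surjective x <;> simp [leafAt_inl, leafAt_inr]

theorem wide_opA : Wide opA := by
  refine ⟨2, fun m t h => ?_⟩
  obtain ⟨a, u, rfl, ha, hu⟩ := exists_mul_of_depth (t := t) (n := m + 1) (by omega)
  obtain ⟨b, c, rfl, hb, hc⟩ := exists_mul_of_depth hu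
  exact ⟨(a * b) * c, rfl, by simp only [depth_mul]; omega⟩

theorem wide_opA_symm : Wide opA.symm := by
  refine ⟨2, fun m t h => ?_⟩
  obtain ⟨u, c, rfl, hu, hc⟩ := exists_mul_of_depth (t := t) (n := m + 1) (by omega)
  obtain ⟨a, b, rfl, ha, hb⟩ := exists_mul_of_depth hu
  exact ⟨a * (b * c), rfl, by simp only [depth_mul]; omega⟩

theorem wide_opC : Wide opC := by
  refine ⟨1, fun m t h => ?_⟩
  obtain ⟨a, b, rfl, ha, hb⟩ := exists_mul_of_depth (t := t) (n := m) (by omega)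
  exact ⟨b * a, rfl, by simp only [depth_mul]; omega⟩

theorem wide_and_compat {f : POp} (hf : f ∈ geometryMonoid) : Wide f ∧ ∃ p, Compat f p := by
  induction hf using Submonoid.closure_induction with
  | mem f h =>
    obtain ⟨α, rfl | rfl | rfl | rfl⟩ := h
    · exact ⟨wide_opA.shift α, exists_compat_shift exists_compat_opA α⟩
    · obtain ⟨p, hp⟩ := exists_compat_shift exists_compat_opA α
      exact ⟨by rw [shift_symm]; exact wide_opA_symm.shift α, _, hp.symm⟩
    · exact ⟨wide_opC.shift α, exists_compat_shift exists_compat_opC α⟩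
    · obtain ⟨p, hp⟩ := exists_compat_shift exists_compat_opC α
      exact ⟨by rw [shift_symm]; exact Wide.shift (f := opC.symm) wide_opC α, _, hp.symm⟩
  | one => exact ⟨Wide.one, 1, Compat.one⟩
  | mul f g _ _ hf hg =>
    obtain ⟨w1, p, hp⟩ := hf
    obtain ⟨w2, q, hq⟩ := hg
    exact ⟨w1.mul w2, _, hp.mul hq⟩

theorem symm_mem {f : POp} (hf : f ∈ geometryMonoid) : f.symm ∈ geometryMonoid := by
  induction hf using Submonoid.closure_induction with
  | mem f h =>
    apply Submonoid.subset_closure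
    obtain ⟨α, rfl | rfl | rfl | rfl⟩ := h
    · exact ⟨α, Or.inr (Or.inl rfl)⟩
    · exact ⟨α, Or.inl rfl⟩
    · exact ⟨α, Or.inr (Or.inr (Or.inr rfl))⟩
    · exact ⟨α, Or.inr (Or.inr (Or.inl rfl))⟩
  | one => exact geometryMonoid.one_mem
  | mul f g _ _ hf hg =>
    have h : (f * g).symm = g.symm * f.symm := PEquiv.symm_trans_rev f g
    rw [h]
    exact geometryMonoid.mul_mem hg hf

/-- On the geometry monoid, near-equality means inducing the same permutation of paths. -/
theorem nearEq_iff {f g : POp} (hf : Wide f) (hg : Wide g) {p q : Equiv.Perm (Stream' Bool)}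
    (hp : Compat f p) (hq : Compat g q) : NearEq f g ↔ p = q := by
  obtain ⟨n, hn⟩ := hf
  obtain ⟨k, hk⟩ := hg
  obtain ⟨t, ht, hinj⟩ := exists_deep (n + k)
  obtain ⟨a, ha, -⟩ := hn 0 t (by omega)
  obtain ⟨b, hb, -⟩ := hk 0 t (by omega)
  constructor
  · intro h
    obtain rfl := h.2 t a b ha hb
    have hinj' : Function.Injective (leafAt a) := by
      intro x y hxy
      obtain ⟨x, rfl⟩ := p.surjective x
      obtain ⟨y, rfl⟩ := p.surjective y
      rw [← hp t a ha, ← hp t a ha] at hxy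
      rw [hinj hxy]
    ext1 x
    exact hinj' (by rw [← hp t a ha, ← hq t a hb])
  · rintro rfl
    refine ⟨⟨t, a, b, ha, hb⟩, fun t a b ha hb => leafAt_injective a b (funext fun x => ?_)⟩
    obtain ⟨x, rfl⟩ := p.surjective x
    rw [← hp t a ha, ← hq t b hb]

/-- Near-equality, as a congruence on the geometry monoid. -/
def nearCon : Con geometryMonoid where
  r f g := NearEq f g
  iseqv := by
    refine ⟨fun f => ?_, fun {f g} h => ?_, fun {f g h} h1 h2 => ?_⟩
    · obtain ⟨w, p, hp⟩ := wide_and_compat f.2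
      exact (nearEq_iff w w hp hp).2 rfl
    · obtain ⟨⟨t, a, b, ha, hb⟩, hh⟩ := h
      exact ⟨⟨t, b, a, hb, ha⟩, fun t a b ha hb => (hh t b a hb ha).symm⟩
    · obtain ⟨w1, p, hp⟩ := wide_and_compat f.2
      obtain ⟨w2, q, hq⟩ := wide_and_compat g.2
      obtain ⟨w3, r, hr⟩ := wide_and_compat h.2
      exact (nearEq_iff w1 w3 hp hr).2
        (((nearEq_iff w1 w2 hp hq).1 h1).trans ((nearEq_iff w2 w3 hq hr).1 h2))
  mul' := by
    intro f g f' g' h1 h2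
    obtain ⟨w1, p, hp⟩ := wide_and_compat f.2
    obtain ⟨w2, q, hq⟩ := wide_and_compat g.2
    obtain ⟨w3, r, hr⟩ := wide_and_compat f'.2
    obtain ⟨w4, s, hs⟩ := wide_and_compat g'.2
    obtain rfl := (nearEq_iff w1 w2 hp hq).1 h1
    obtain rfl := (nearEq_iff w3 w4 hr hs).1 h2
    exact (nearEq_iff (w1.mul w3) (w2.mul w4) (hp.mul hr) (hq.mul hs)).2 rfl

/-- Inverse of a partial injection, inside the geometry monoid. -/
def monoidInv (f : geometryMonoid) : geometryMonoid := ⟨(f : POp).symm, symm_mem f.2⟩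

theorem monoidInv_rel {f g : geometryMonoid} (h : nearCon f g) :
    nearCon (monoidInv f) (monoidInv g) := by
  obtain ⟨w1, p, hp⟩ := wide_and_compat f.2
  obtain ⟨w2, q, hq⟩ := wide_and_compat g.2
  obtain rfl := (nearEq_iff w1 w2 hp hq).1 h
  exact (nearEq_iff (wide_and_compat (symm_mem f.2)).1 (wide_and_compat (symm_mem g.2)).1
    hp.symm hq.symm).2 rfl

theorem monoidInv_mul_rel (f : geometryMonoid) : nearCon (monoidInv f * f) 1 := by
  obtain ⟨w1, p, hp⟩ := wide_and_compat f.2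
  have w2 := (wide_and_compat (symm_mem f.2)).1
  exact (nearEq_iff (w2.mul w1) Wide.one (hp.symm.mul hp) Compat.one).2 (mul_inv_cancel p)

/-- The geometry group of associativity and commutativity (Thompson's group `V`): the quotient
of the geometry monoid by near-equality. -/
def GeometryGroup : Type := nearCon.Quotient

instance instGroupGeometryGroup : Group GeometryGroup :=
  { (inferInstance : Monoid nearCon.Quotient) with
    inv := Quotient.map monoidInv fun _ _ h => monoidInv_rel h
    inv_mul_cancel := fun x =>
      Quotient.inductionOn x fun f => nearCon.eq.2 (monoidInv_mul_rel f) }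

/-- The class of an element of the geometry monoid in the geometry group. -/
def cls : geometryMonoid →* GeometryGroup := nearCon.mk'

/-- The element `A_α` of the geometry group. -/
def elA (α : Address) : GeometryGroup :=
  cls ⟨shift α opA, Submonoid.subset_closure ⟨α, Or.inl rfl⟩⟩

/-- The element `C_α` of the geometry group. -/
def elC (α : Address) : GeometryGroup :=
  cls ⟨shift α opC, Submonoid.subset_closure ⟨α, Or.inr (Or.inr (Or.inl rfl))⟩⟩

/-- The element `S_α = C_α A_α⁻¹ C_{α1}⁻¹` of the geometry group: it acts by
`t₁(t₂t₃) ↦ t₂(t₁t₃)` on the `α`-subtree. -/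
def elS (α : Address) : GeometryGroup := elC α * (elA α)⁻¹ * (elC (α ++ [true]))⁻¹

/-- The two families of generators. -/
inductive Kind : Type
  | A : Kind
  | S : Kind

/-- The element `A_α` or `S_α` of the geometry group. -/
def el : Kind → Address → GeometryGroup
  | Kind.A, α => elA α
  | Kind.S, α => elS α

/-- The group `𝔖_•`: the subgroup of the geometry group generated by all `A_α` and `S_α`. -/
def SBullet : Subgroup GeometryGroup := Subgroup.closure {g | ∃ X α, g = el X α}

/-- The letter `X_α`, with `X` being `A` or `S`, in the free group on all letters `A_α`, `S_α`. -/
def ltr (X : Kind) (α : Address) : FreeGroup (Kind × Address) := FreeGroup.of (X, α)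

/-- `∂_γ w`: append `γ` at the beginning of each index in the word `w`. -/
def shiftWord (γ : Address) : FreeGroup (Kind × Address) →* FreeGroup (Kind × Address) :=
  FreeGroup.map fun x => (x.1, γ ++ x.2)

open Kind in
/-- The untranslated relations of `R_AS`: `BaseRel u v` stands for the relation `u = v`.
Here `0` is `false` and `1` is `true`. -/
inductive BaseRel : FreeGroup (Kind × Address) → FreeGroup (Kind × Address) → Prop
  -- geometric relations, disjoint addresses
  | perp (X Y : Kind) (α β : Address) :
      BaseRel (ltr X (false :: α) * ltr Y (true :: β)) (ltr Y (true :: β) * ltr X (false :: α))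
  -- geometric relations for `A`
  | geomA11 (X : Kind) (α : Address) :
      BaseRel (ltr X (true :: true :: α) * ltr A []) (ltr A [] * ltr X (true :: α))
  | geomA10 (X : Kind) (α : Address) :
      BaseRel (ltr X (true :: false :: α) * ltr A []) (ltr A [] * ltr X (false :: true :: α))
  | geomA0 (X : Kind) (α : Address) :
      BaseRel (ltr X (false :: α) * ltr A []) (ltr A [] * ltr X (false :: false :: α))
  -- geometric relations for `S`
  | geomS11 (X : Kind) (α : Address) :
      BaseRel (ltr X (true :: true :: α) * ltr S []) (ltr S [] * ltr X (true :: true :: α))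
  | geomS10 (X : Kind) (α : Address) :
      BaseRel (ltr X (true :: false :: α) * ltr S []) (ltr S [] * ltr X (false :: α))
  | geomS0 (X : Kind) (α : Address) :
      BaseRel (ltr X (false :: α) * ltr S []) (ltr S [] * ltr X (true :: false :: α))
  -- pentagon relation
  | pentagon : BaseRel (ltr A [] * ltr A []) (ltr A [true] * ltr A [] * ltr A [false])
  -- `S A₁ A = A₁ A S₀`, `S₁ S A₁ = A S`, `S S₁ A = A₁ S`, `S S₁ S = S₁ S S₁`
  | mixed1 : BaseRel (ltr S [] * ltr A [true] * ltr A []) (ltr A [true] * ltr A [] * ltr S [false])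
  | mixed2 : BaseRel (ltr S [true] * ltr S [] * ltr A [true]) (ltr A [] * ltr S [])
  | mixed3 : BaseRel (ltr S [] * ltr S [true] * ltr A []) (ltr A [true] * ltr S [])
  | braid : BaseRel (ltr S [] * ltr S [true] * ltr S []) (ltr S [true] * ltr S [] * ltr S [true])

/-- `R_AS`: all translated copies of the above relations. The relation `u = v` is encoded by the
element `u v⁻¹` of the free group. -/
def relAS : Set (FreeGroup (Kind × Address)) :=
  {r | ∃ (γ : Address) (u v : FreeGroup (Kind × Address)),
    BaseRel u v ∧ r = shiftWord γ u * (shiftWord γ v)⁻¹}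

/-- The torsion relations `S_α² = 1`. -/
def relTorsion : Set (FreeGroup (Kind × Address)) :=
  {r | ∃ α : Address, r = ltr Kind.S α ^ 2}

end TreeGeometry

namespace TreeGeometry

open Stream' (cons)

/-! On the geometry monoid, near-equality means inducing the same permutation of infinite paths, so
the geometry group acts faithfully on paths (`action_injective`). In this picture each relation is a
finite check on prefixes, and the presented group maps onto `SBullet`. The real content is
injectivity.

The pentagon and S A₁ A = A₁ A S₀ express A₀ and S₀ through letters at addresses 1ⁱ, and conjugation
by A then reaches all other addresses. So the presented group is generated by aᵢ = A_{1ⁱ} ("merges")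
and sᵢ = S_{1ⁱ} ("swaps") (`onesSubgroup_eq_top`). They satisfy `CombRelations`: relations of
Thompson's group F among the aᵢ, Coxeter relations of a symmetric group among the sᵢ, and mixed
relations by which swaps pass to the left of merges. Hence every element is a fraction f⁻¹σg, with
f, g products of merges and σ a product of swaps (`CombRelations.exists_fraction`).

If f⁻¹σg acts trivially, then σ acts as fg⁻¹ and so preserves the lexicographic order. But σ
permutes the cones below the vertices 1ⁱ0, and a monotone permutation of ℕ is trivial; a double
coset decomposition derived from the relations (`CombRelations.mem_swapsBelow_succ`) then gives σ =
1. Now f and g act equally; both can be sorted by index, and the action determines a sorted product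
(`CombRelations.mergeProd_injOn`), so f = g. -/

/-! ### Permutations of the space of infinite paths -/

/-- Infinite paths in the complete binary tree. -/
abbrev Path : Type := Stream' Bool

theorem exists_cons (x : Path) : ∃ (b : Bool) (y : Path), x = cons b y :=
  ⟨x.head, x.tail, (Stream'.eta x).symm⟩

/-- Let a permutation of paths act below the vertex `b`. -/
def under (b : Bool) : Equiv.Perm Path →* Equiv.Perm Path where
  toFun p :=
    { toFun := fun x => if x.head = b then cons b (p x.tail) else x
      invFun := fun x => if x.head = b then cons b (p⁻¹ x.tail) else x
      left_inv := fun x => by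
        obtain ⟨c, x, rfl⟩ := exists_cons x
        by_cases h : c = b <;> simp [h]
      right_inv := fun x => by
        obtain ⟨c, x, rfl⟩ := exists_cons x
        by_cases h : c = b <;> simp [h] }
  map_one' := by
    ext1 x
    obtain ⟨c, x, rfl⟩ := exists_cons x
    by_cases h : c = b <;> simp [h]
  map_mul' p q := by
    ext1 x
    obtain ⟨c, x, rfl⟩ := exists_cons x
    by_cases h : c = b <;> simp [h]

@[simp] theorem under_cons_self (b : Bool) (p : Equiv.Perm Path) (x : Path) :
    under b p (cons b x) = cons b (p x) := by
  simp [under]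

theorem under_cons_of_ne {b c : Bool} (h : c ≠ b) (p : Equiv.Perm Path) (x : Path) :
    under b p (cons c x) = cons c x := by
  simp [under, h]

@[simp] theorem under_true_cons_false (p : Equiv.Perm Path) (x : Path) :
    under true p (cons false x) = cons false x := under_cons_of_ne (by simp) p x

@[simp] theorem under_false_cons_true (p : Equiv.Perm Path) (x : Path) :
    under false p (cons true x) = cons true x := under_cons_of_ne (by simp) p x

/-- Let a permutation of paths act below the vertex `α`. -/
def below : Address → Equiv.Perm Path →* Equiv.Perm Path
  | [] => MonoidHom.id _
  | b :: α => (under b).comp (below α)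

@[simp] theorem below_nil (p : Equiv.Perm Path) : below [] p = p := rfl

@[simp] theorem below_cons (b : Bool) (α : Address) (p : Equiv.Perm Path) :
    below (b :: α) p = under b (below α p) := rfl

theorem below_append (α β : Address) (p : Equiv.Perm Path) :
    below (α ++ β) p = below α (below β p) := by
  induction α with
  | nil => rfl
  | cons b α ih => simp [ih]

/-- The permutation `00x ↦ 0x`, `01x ↦ 10x`, `1x ↦ 11x` of paths. -/
def permA : Equiv.Perm Path where
  toFun x := bif x.head then cons true (cons true x.tail) else
    bif x.tail.head then cons true (cons false x.tail.tail) else cons false x.tail.tail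
  invFun x := bif x.head then
    (bif x.tail.head then cons true x.tail.tail else cons false (cons true x.tail.tail)) else
    cons false (cons false x.tail)
  left_inv x := by
    obtain ⟨b, x, rfl⟩ := exists_cons x
    obtain ⟨c, x, rfl⟩ := exists_cons x
    cases b <;> cases c <;> rfl
  right_inv x := by
    obtain ⟨b, x, rfl⟩ := exists_cons x
    obtain ⟨c, x, rfl⟩ := exists_cons x
    cases b <;> cases c <;> rfl

@[simp] theorem permA_true (x : Path) : permA (cons true x) = cons true (cons true x) := rfl

@[simp] theorem permA_false_true (x : Path) :
    permA (cons false (cons true x)) = cons true (cons false x) := rfl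

@[simp] theorem permA_false_false (x : Path) :
    permA (cons false (cons false x)) = cons false x := rfl

/-- The permutation `0x ↦ 1x`, `1x ↦ 0x` of paths. -/
def permC : Equiv.Perm Path where
  toFun x := cons (!x.head) x.tail
  invFun x := cons (!x.head) x.tail
  left_inv x := by
    obtain ⟨b, x, rfl⟩ := exists_cons x
    cases b <;> rfl
  right_inv x := by
    obtain ⟨b, x, rfl⟩ := exists_cons x
    cases b <;> rfl

@[simp] theorem permC_cons (b : Bool) (x : Path) : permC (cons b x) = cons (!b) x := rfl

/-- The permutation `0x ↦ 10x`, `10x ↦ 0x`, `11x ↦ 11x` of paths. -/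
def permS : Equiv.Perm Path := permC * permA⁻¹ * (under true permC)⁻¹

@[simp] theorem permS_false (x : Path) : permS (cons false x) = cons true (cons false x) := by
  have h : (under true permC)⁻¹ (cons false x) = cons false x := by
    rw [Equiv.Perm.inv_eq_iff_eq, under_true_cons_false]
  rw [permS, Equiv.Perm.mul_apply, Equiv.Perm.mul_apply, h]
  rfl

@[simp] theorem permS_true_false (x : Path) :
    permS (cons true (cons false x)) = cons false x := by
  have h : (under true permC)⁻¹ (cons true (cons false x)) = cons true (cons true x) := by
    rw [Equiv.Perm.inv_eq_iff_eq, under_cons_self]; rfl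
  rw [permS, Equiv.Perm.mul_apply, Equiv.Perm.mul_apply, h]
  rfl

@[simp] theorem permS_true_true (x : Path) :
    permS (cons true (cons true x)) = cons true (cons true x) := by
  have h : (under true permC)⁻¹ (cons true (cons true x)) = cons true (cons false x) := by
    rw [Equiv.Perm.inv_eq_iff_eq, under_cons_self]; rfl
  rw [permS, Equiv.Perm.mul_apply, Equiv.Perm.mul_apply, h]
  rfl

/-! ### The geometry group acts faithfully on paths -/

/-- A wide `f` is near-equal to itself, so `nearEq_iff` applies with `f` on both sides. -/
theorem Compat.unique {f : POp} (hf : Wide f) {p q : Equiv.Perm Path} (hp : Compat f p)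
    (hq : Compat f q) : p = q := by
  obtain ⟨n, hn⟩ := hf
  obtain ⟨t, ht, -⟩ := exists_deep n
  obtain ⟨a, ha, -⟩ := hn 0 t (by omega)
  exact (nearEq_iff ⟨n, hn⟩ ⟨n, hn⟩ hp hq).1
    ⟨⟨t, a, a, ha, ha⟩, fun t a b h1 h2 => Option.some.inj (h1.symm.trans h2)⟩

/-- The inverse of the permutation of paths induced by an element of the geometry monoid. -/
noncomputable def monoidAction : geometryMonoid →* Equiv.Perm Path where
  -- Products in the monoid are read from left to right and those of permutations from right to left
  -- (`Compat.mul`); the inverse turns the antihomomorphism into a homomorphism.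
  toFun f := (wide_and_compat f.2).2.choose⁻¹
  map_one' := by
    rw [inv_eq_one]
    exact Compat.unique Wide.one (wide_and_compat (1 : geometryMonoid).2).2.choose_spec Compat.one
  map_mul' f g := by
    rw [← mul_inv_rev, inv_inj]
    exact Compat.unique (wide_and_compat (f * g).2).1 (wide_and_compat (f * g).2).2.choose_spec
      ((wide_and_compat f.2).2.choose_spec.mul (wide_and_compat g.2).2.choose_spec)

theorem monoidAction_compat (f : geometryMonoid) : Compat f (monoidAction f)⁻¹ := by
  change Compat f (_⁻¹)⁻¹
  rw [inv_inv]
  exact (wide_and_compat f.2).2.choose_spec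

theorem monoidAction_eq {f : geometryMonoid} {p : Equiv.Perm Path} (h : Compat f p⁻¹) :
    monoidAction f = p :=
  inv_injective (Compat.unique (wide_and_compat f.2).1 (monoidAction_compat f) h)

theorem monoidAction_eq_iff {f g : geometryMonoid} :
    monoidAction f = monoidAction g ↔ nearCon f g := by
  rw [← inv_inj]
  exact (nearEq_iff (wide_and_compat f.2).1 (wide_and_compat g.2).1 (monoidAction_compat f)
    (monoidAction_compat g)).symm

/-- The action of the geometry group on paths. -/
noncomputable def action : GeometryGroup →* Equiv.Perm Path :=
  nearCon.lift monoidAction fun _ _ h => monoidAction_eq_iff.2 h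

theorem action_injective : Function.Injective action := by
  intro x y h
  induction x using Quotient.inductionOn with | _ f =>
  induction y using Quotient.inductionOn with | _ g =>
  exact nearCon.eq.2 (monoidAction_eq_iff.1 h)

theorem leafAt_cons_false (a b : CTree) (x : Path) :
    leafAt (a * b) (cons false x) = leafAt a x := rfl

theorem leafAt_cons_true (a b : CTree) (x : Path) :
    leafAt (a * b) (cons true x) = leafAt b x := rfl

/-- The subtrees at 0, 10, 11 go to 00, 01, 1, which is `permA` read backwards. -/
theorem compat_opA : Compat opA permA⁻¹ := by
  intro t t' h x
  rcases t with _ | ⟨a, _ | ⟨b, c⟩⟩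
  · cases h
  · cases h
  · obtain rfl : (a * b) * c = t' := Option.some.inj h
    change leafAt (a * (b * c)) x = _
    obtain ⟨d, x, rfl⟩ := exists_cons x
    obtain ⟨e, x, rfl⟩ := exists_cons x
    cases d <;> cases e <;> rfl

theorem compat_opC : Compat opC permC⁻¹ := by
  intro t t' h x
  rcases t with _ | ⟨a, b⟩
  · cases h
  · obtain rfl : b * a = t' := Option.some.inj h
    change leafAt (a * b) x = _
    obtain ⟨d, x, rfl⟩ := exists_cons x
    cases d <;> rfl

theorem Compat.shift {f : POp} {p : Equiv.Perm Path} (h : Compat f p) :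
    ∀ α, Compat (shift α f) (below α p)
  | [] => h
  | false :: α => by
    intro t t' ht x
    obtain ⟨a, b, a', rfl, h1, rfl⟩ := mem_onLeft.1 ht
    obtain ⟨d, x, rfl⟩ := exists_cons x
    cases d
    · simpa [leafAt_cons_false] using Compat.shift h α a a' h1 x
    · simp [leafAt_cons_true]
  | true :: α => by
    intro t t' ht x
    obtain ⟨a, b, b', rfl, h1, rfl⟩ := mem_onRight.1 ht
    obtain ⟨d, x, rfl⟩ := exists_cons x
    cases d
    · simp [leafAt_cons_false]
    · simpa [leafAt_cons_true] using Compat.shift h α b b' h1 x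

theorem action_elA (α : Address) : action (elA α) = below α permA :=
  monoidAction_eq (by rw [← map_inv]; exact compat_opA.shift α)

theorem action_elC (α : Address) : action (elC α) = below α permC :=
  monoidAction_eq (by rw [← map_inv]; exact compat_opC.shift α)

theorem action_elS (α : Address) : action (elS α) = below α permS := by
  rw [elS, map_mul, map_mul, map_inv, map_inv, action_elA, action_elC, action_elC, below_append,
    permS, map_mul, map_mul, map_inv, map_inv]
  rfl

/-- The permutation of paths attached to a generator at the root. -/
def kindPerm : Kind → Equiv.Perm Path
  | Kind.A => permA
  | Kind.S => permS

@[simp] theorem kindPerm_A : kindPerm Kind.A = permA := rfl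

@[simp] theorem kindPerm_S : kindPerm Kind.S = permS := rfl

theorem action_el (X : Kind) (α : Address) : action (el X α) = below α (kindPerm X) := by
  cases X
  · exact action_elA α
  · exact action_elS α

/-! ### The relations hold in the geometry group -/

/-- The action on paths of a word in the letters `A_α`, `S_α`. -/
noncomputable def wordAction : FreeGroup (Kind × Address) →* Equiv.Perm Path :=
  FreeGroup.lift fun x => below x.2 (kindPerm x.1)

@[simp] theorem wordAction_ltr (X : Kind) (α : Address) :
    wordAction (ltr X α) = below α (kindPerm X) := FreeGroup.lift_apply_of

theorem wordAction_shiftWord (γ : Address) (w : FreeGroup (Kind × Address)) :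
    wordAction (shiftWord γ w) = below γ (wordAction w) := by
  have : wordAction.comp (shiftWord γ) = (below γ).comp wordAction := by
    ext1 x
    simp [wordAction, shiftWord, below_append]
  exact DFunLike.congr_fun this w

/-- Four letters suffice to evaluate both sides of every base relation, and the tail stays abstract.
-/
theorem perm_ext_of_cons {p q : Equiv.Perm Path}
    (h : ∀ b c d e x, p (cons b (cons c (cons d (cons e x)))) =
      q (cons b (cons c (cons d (cons e x))))) : p = q := by
  ext1 x
  obtain ⟨b, x, rfl⟩ := exists_cons x
  obtain ⟨c, x, rfl⟩ := exists_cons x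
  obtain ⟨d, x, rfl⟩ := exists_cons x
  obtain ⟨e, x, rfl⟩ := exists_cons x
  exact h b c d e x

theorem wordAction_eq_of_baseRel {u v : FreeGroup (Kind × Address)} (h : BaseRel u v) :
    wordAction u = wordAction v := by
  cases h <;> refine perm_ext_of_cons fun b c d e x => ?_ <;>
    cases b <;> cases c <;> cases d <;> cases e <;> simp

theorem wordAction_eq_one {r : FreeGroup (Kind × Address)} (h : r ∈ relAS ∪ relTorsion) :
    wordAction r = 1 := by
  rcases h with ⟨γ, u, v, h, rfl⟩ | ⟨α, rfl⟩
  · rw [map_mul, map_inv, wordAction_shiftWord, wordAction_shiftWord, wordAction_eq_of_baseRel h,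
      mul_inv_cancel]
  · rw [map_pow, wordAction_ltr, ← map_pow]
    have : kindPerm Kind.S ^ 2 = 1 := by
      refine perm_ext_of_cons fun b c d e x => ?_
      cases b <;> cases c <;> simp [pow_two]
    rw [this, map_one]

/-! ### Fractions of forests and permutations -/

/-- The relations between the elements `a i`, merging the `i`th and the next leaf of an infinite
comb, and `s i`, exchanging these leaves. -/
structure CombRelations {G : Type*} [Group G] (a s : ℕ → G) : Prop where
  merge_merge : ∀ i j, i < j → a (j + 1) * a i = a i * a j
  swap_merge : ∀ i j, i < j → s (j + 1) * a i = a i * s j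
  merge_swap : ∀ i j, i + 2 ≤ j → a j * s i = s i * a j
  merge_swap_self : ∀ i, s (i + 1) * s i * a (i + 1) = a i * s i
  merge_swap_succ : ∀ i, s i * s (i + 1) * a i = a (i + 1) * s i
  swap_swap : ∀ i j, i + 2 ≤ j → s j * s i = s i * s j
  braid : ∀ i, s i * s (i + 1) * s i = s (i + 1) * s i * s (i + 1)
  swap_mul_self : ∀ i, s i * s i = 1

namespace CombRelations

variable {G : Type*} [Group G] {a s : ℕ → G}

theorem inv_swap (h : CombRelations a s) (i : ℕ) : (s i)⁻¹ = s i :=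
  inv_eq_of_mul_eq_one_left (h.swap_mul_self i)

/-- The subgroup generated by all `s i`. -/
abbrev swaps (s : ℕ → G) : Subgroup G := Subgroup.closure (Set.range s)

/-- The submonoid generated by all `a i`. -/
abbrev merges (a : ℕ → G) : Submonoid G := Submonoid.closure (Set.range a)

/-- The cases `k < i`, `k = i`, `k = i + 1`, `k ≥ i + 2` are `swap_merge`, `merge_swap_self`,
`merge_swap_succ`, `merge_swap`. In each, exactly one merge survives on the right. -/
theorem merge_mul_swap (h : CombRelations a s) (k i : ℕ) :
    ∃ l, ∃ σ ∈ swaps s, a k * s i = σ * a l := by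
  have hs : ∀ i, s i ∈ swaps s := fun i => Subgroup.subset_closure ⟨i, rfl⟩
  rcases lt_or_ge k i with hk | hk
  · exact ⟨k, s (i + 1), hs _, (h.swap_merge k i hk).symm⟩
  · obtain rfl | rfl | hk : k = i ∨ k = i + 1 ∨ i + 2 ≤ k := by omega
    · exact ⟨k + 1, s (k + 1) * s k, mul_mem (hs _) (hs _), (h.merge_swap_self k).symm⟩
    · exact ⟨i, s i * s (i + 1), mul_mem (hs _) (hs _), (h.merge_swap_succ i).symm⟩
    · exact ⟨k, s i, hs _, h.merge_swap i k hk⟩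

theorem merge_mul_swaps (h : CombRelations a s) {σ : G} (hσ : σ ∈ swaps s) (k : ℕ) :
    ∃ l, ∃ τ ∈ swaps s, a k * σ = τ * a l := by
  induction hσ using Subgroup.closure_induction_right with
  | one => exact ⟨k, 1, one_mem _, by simp⟩
  | mul_right σ _ y hy ih =>
    obtain ⟨i, rfl⟩ := hy
    obtain ⟨l, τ, hτ, e⟩ := ih
    obtain ⟨m, ρ, hρ, e'⟩ := h.merge_mul_swap l i
    exact ⟨m, τ * ρ, mul_mem hτ hρ, by rw [← mul_assoc, e, mul_assoc, e', mul_assoc]⟩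
  | mul_inv_cancel σ _ y hy ih =>
    obtain ⟨i, rfl⟩ := hy
    obtain ⟨l, τ, hτ, e⟩ := ih
    obtain ⟨m, ρ, hρ, e'⟩ := h.merge_mul_swap l i
    exact ⟨m, τ * ρ, mul_mem hτ hρ, by
      rw [h.inv_swap, ← mul_assoc, e, mul_assoc, e', mul_assoc]⟩

theorem merges_mul_swaps (h : CombRelations a s) {f : G} (hf : f ∈ merges a) {σ : G}
    (hσ : σ ∈ swaps s) : ∃ g ∈ merges a, ∃ τ ∈ swaps s, f * σ = τ * g := by
  induction hf using Submonoid.closure_induction_left with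
  | one => exact ⟨1, one_mem _, σ, hσ, by simp⟩
  | mul_left x hx f _ ih =>
    obtain ⟨k, rfl⟩ := hx
    obtain ⟨g, hg, τ, hτ, e⟩ := ih
    obtain ⟨l, ρ, hρ, e'⟩ := h.merge_mul_swaps hτ k
    exact ⟨a l * g, mul_mem (Submonoid.subset_closure ⟨l, rfl⟩) hg, ρ, hρ, by
      rw [mul_assoc, e, ← mul_assoc, e', mul_assoc]⟩

theorem swaps_mul_inv_merge (h : CombRelations a s) {σ : G} (hσ : σ ∈ swaps s) (k : ℕ) :
    ∃ l, ∃ τ ∈ swaps s, σ * (a k)⁻¹ = (a l)⁻¹ * τ := by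
  obtain ⟨l, τ, hτ, e⟩ := h.merge_mul_swaps (inv_mem hσ) k
  refine ⟨l, τ⁻¹, inv_mem hτ, ?_⟩
  rw [← inv_inj]
  simpa using e

/-- By `merge_merge`, an inverse merge travels left across the merges one at a time, shifting an
index by one, until it meets its own merge and cancels or reaches the left end. It is never
duplicated. -/
theorem merges_mul_inv_merge (h : CombRelations a s) {f : G} (hf : f ∈ merges a) (i : ℕ) :
    f * (a i)⁻¹ ∈ merges a ∨ ∃ j, ∃ g ∈ merges a, f * (a i)⁻¹ = (a j)⁻¹ * g := by
  have ha : ∀ i, a i ∈ merges a := fun i => Submonoid.subset_closure ⟨i, rfl⟩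
  induction hf using Submonoid.closure_induction_left with
  | one => exact Or.inr ⟨i, 1, one_mem _, by simp⟩
  | mul_left x hx f _ ih =>
    obtain ⟨k, rfl⟩ := hx
    rcases ih with ih | ⟨j, g, hg, e⟩
    · exact Or.inl (by rw [mul_assoc]; exact mul_mem (ha k) ih)
    · rw [mul_assoc, e]
      rcases lt_trichotomy j k with hjk | rfl | hjk
      · refine Or.inr ⟨j, a (k + 1) * g, mul_mem (ha _) hg, ?_⟩
        rw [← mul_assoc, ← mul_assoc]
        congr 1
        rw [mul_inv_eq_iff_eq_mul, mul_assoc, h.merge_merge j k hjk, inv_mul_cancel_left]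
      · exact Or.inl (by simpa using hg)
      · refine Or.inr ⟨j + 1, a k * g, mul_mem (ha _) hg, ?_⟩
        rw [← mul_assoc, ← mul_assoc]
        congr 1
        rw [mul_inv_eq_iff_eq_mul, mul_assoc, ← h.merge_merge k j hjk, inv_mul_cancel_left]

/-- Every element of the group generated by the `a i` and the `s i` is a fraction. -/
theorem exists_fraction (h : CombRelations a s) {x : G}
    (hx : x ∈ Subgroup.closure (Set.range a ∪ Set.range s)) :
    ∃ f ∈ merges a, ∃ σ ∈ swaps s, ∃ g ∈ merges a, x = f⁻¹ * σ * g := by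
  have ha : ∀ i, a i ∈ merges a := fun i => Submonoid.subset_closure ⟨i, rfl⟩
  have hs : ∀ i, s i ∈ swaps s := fun i => Subgroup.subset_closure ⟨i, rfl⟩
  have step : ∀ x, (∃ f ∈ merges a, ∃ σ ∈ swaps s, ∃ g ∈ merges a, x = f⁻¹ * σ * g) → ∀ i,
      ∃ f ∈ merges a, ∃ σ ∈ swaps s, ∃ g ∈ merges a, x * s i = f⁻¹ * σ * g := by
    rintro _ ⟨f, hf, σ, hσ, g, hg, rfl⟩ i
    obtain ⟨g', hg', τ, hτ, e⟩ := h.merges_mul_swaps hg (hs i)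
    exact ⟨f, hf, σ * τ, mul_mem hσ hτ, g', hg', by rw [mul_assoc, e]; group⟩
  induction hx using Subgroup.closure_induction_right with
  | one => exact ⟨1, one_mem _, 1, one_mem _, 1, one_mem _, by simp⟩
  | mul_right x _ y hy ih =>
    rcases hy with ⟨i, rfl⟩ | ⟨i, rfl⟩
    · obtain ⟨f, hf, σ, hσ, g, hg, rfl⟩ := ih
      exact ⟨f, hf, σ, hσ, g * a i, mul_mem hg (ha i), by group⟩
    · exact step _ ih i
  | mul_inv_cancel x _ y hy ih =>
    rcases hy with ⟨i, rfl⟩ | ⟨i, rfl⟩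
    · obtain ⟨f, hf, σ, hσ, g, hg, rfl⟩ := ih
      rcases h.merges_mul_inv_merge hg i with h1 | ⟨j, g', hg', e⟩
      · exact ⟨f, hf, σ, hσ, _, h1, by group⟩
      · obtain ⟨l, τ, hτ, e'⟩ := h.swaps_mul_inv_merge hσ j
        -- The inverse merge has crossed `g`, then `σ`, and is absorbed in the denominator: `f⁻¹ *
        -- (a l)⁻¹ = (a l * f)⁻¹`.
        refine ⟨a l * f, mul_mem (ha l) hf, τ, hτ, g', hg', ?_⟩
        rw [mul_assoc, e, mul_assoc, ← mul_assoc σ, e']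
        group
    · rw [h.inv_swap]
      exact step _ ih i

/-! ### Sorted forests -/

/-- The product of the `a i` along a list, the head of the list being the last factor. -/
def mergeProd (a : ℕ → G) : List ℕ → G
  | [] => 1
  | i :: l => mergeProd a l * a i

/-- Insertion sort: for `j < i`, `a j * a i = a (i + 1) * a j` moves the new factor inwards at the
cost of raising its index. The clause on lower bounds keeps the head `j` minimal after the recursive
insertion. -/
theorem exists_sorted_mul (h : CombRelations a s) (l : List ℕ) :
    ∀ i, l.Pairwise (· ≤ ·) → ∃ m : List ℕ, m.Pairwise (· ≤ ·) ∧
      (∀ b, b ≤ i → (∀ k ∈ l, b ≤ k) → ∀ k ∈ m, b ≤ k) ∧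
      mergeProd a l * a i = mergeProd a m := by
  induction l with
  | nil => exact fun i _ => ⟨[i], by simp, by simp, rfl⟩
  | cons j l ih =>
    intro i hl
    rw [List.pairwise_cons] at hl
    rcases le_or_gt i j with hij | hij
    · refine ⟨i :: j :: l, ?_, ?_, rfl⟩
      · rw [List.pairwise_cons, List.pairwise_cons]
        refine ⟨fun k hk => ?_, hl⟩
        rcases List.mem_cons.1 hk with rfl | hk
        · exact hij
        · exact hij.trans (hl.1 k hk)
      · intro b hb h1 k hk
        rcases List.mem_cons.1 hk with rfl | hk
        · exact hb
        · exact h1 k hk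
    · obtain ⟨m, hm, hb, e⟩ := ih (i + 1) hl.2
      refine ⟨j :: m, ?_, ?_, ?_⟩
      · rw [List.pairwise_cons]
        exact ⟨hb j (by omega) hl.1, hm⟩
      · intro b hbi h1 k hk
        rcases List.mem_cons.1 hk with rfl | hk
        · exact h1 k (by simp)
        · exact hb b (by omega) (fun k hk => h1 k (by simp [hk])) k hk
      · rw [mergeProd, mul_assoc, ← h.merge_merge j i hij, ← mul_assoc, e, mergeProd]

theorem exists_sorted (h : CombRelations a s) {f : G} (hf : f ∈ merges a) :
    ∃ l : List ℕ, l.Pairwise (· ≤ ·) ∧ f = mergeProd a l := by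
  induction hf using Submonoid.closure_induction_right with
  | one => exact ⟨[], by simp, rfl⟩
  | mul_right f _ y hy ih =>
    obtain ⟨i, rfl⟩ := hy
    obtain ⟨l, hl, rfl⟩ := ih
    obtain ⟨m, hm, -, e⟩ := h.exists_sorted_mul l i hl
    exact ⟨m, hm, e⟩

/-! ### Cosets in the group of finite permutations -/

/-- The subgroup generated by the `s i` with `i < n`. -/
abbrev swapsBelow (s : ℕ → G) (n : ℕ) : Subgroup G := Subgroup.closure (s '' Set.Iio n)

theorem commute_swapsBelow (h : CombRelations a s) {n : ℕ} {x : G} (hx : x ∈ swapsBelow s n) :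
    Commute (s (n + 1)) x := by
  induction hx using Subgroup.closure_induction with
  | mem x hx =>
    obtain ⟨i, hi, rfl⟩ := hx
    exact h.swap_swap i (n + 1) (by simpa using Nat.succ_le_succ (Set.mem_Iio.1 hi))
  | one => exact Commute.one_right _
  | mul x y _ _ hx hy => exact hx.mul_right hy
  | inv x _ hx => exact hx.inv_right

theorem swapsBelow_mono (s : ℕ → G) : Monotone (swapsBelow s) := fun _ _ hmn =>
  Subgroup.closure_mono (Set.image_mono (Set.Iio_subset_Iio hmn))

/-- Write W for `swapsBelow s n`. Once s_n W s_n lies in W ∪ W s_n W, this union is stable under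
right multiplication by the generators. The inclusion is kept as a hypothesis because its own
inductive proof uses this lemma one level down. -/
theorem mem_swapsBelow_succ_of_conj (h : CombRelations a s) {n : ℕ}
    (hn : ∀ z ∈ swapsBelow s n, s n * z * s n ∈ swapsBelow s n ∨
      ∃ y ∈ swapsBelow s n, ∃ z' ∈ swapsBelow s n, s n * z * s n = y * s n * z')
    {x : G} (hx : x ∈ swapsBelow s (n + 1)) :
    x ∈ swapsBelow s n ∨ ∃ y ∈ swapsBelow s n, ∃ z ∈ swapsBelow s n, x = y * s n * z := by
  have step : ∀ x, (x ∈ swapsBelow s n ∨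
      ∃ y ∈ swapsBelow s n, ∃ z ∈ swapsBelow s n, x = y * s n * z) → ∀ m < n + 1,
      (x * s m ∈ swapsBelow s n ∨
        ∃ y ∈ swapsBelow s n, ∃ z ∈ swapsBelow s n, x * s m = y * s n * z) := by
    intro x hx m hm
    rcases Nat.lt_succ_iff_lt_or_eq.1 hm with hm | rfl
    · have hs : s m ∈ swapsBelow s n := Subgroup.subset_closure ⟨m, hm, rfl⟩
      rcases hx with hx | ⟨y, hy, z, hz, rfl⟩
      · exact Or.inl (mul_mem hx hs)
      · exact Or.inr ⟨y, hy, z * s m, mul_mem hz hs, by group⟩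
    · rcases hx with hx | ⟨y, hy, z, hz, rfl⟩
      · exact Or.inr ⟨x, hx, 1, one_mem _, by simp⟩
      · have e : y * s m * z * s m = y * (s m * z * s m) := by group
        rw [e]
        rcases hn z hz with hw | ⟨y', hy', z', hz', e'⟩
        · exact Or.inl (mul_mem hy hw)
        · exact Or.inr ⟨y * y', mul_mem hy hy', z', hz', by rw [e']; group⟩
  induction hx using Subgroup.closure_induction_right with
  | one => exact Or.inl (one_mem _)
  | mul_right x _ y hy ih =>
    obtain ⟨m, hm, rfl⟩ := hy
    exact step x ih m hm
  | mul_inv_cancel x _ y hy ih =>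
    obtain ⟨m, hm, rfl⟩ := hy
    rw [h.inv_swap]
    exact step x ih m hm

/-- In the inductive step `z` either commutes with `s (n + 1)`, which then cancels, or is `x * s n *
y` with `x`, `y` commuting with `s (n + 1)`. In the latter case the braid relation rewrites the
middle. -/
theorem conj_mem_swapsBelow (h : CombRelations a s) (n : ℕ) :
    ∀ z ∈ swapsBelow s n, s n * z * s n ∈ swapsBelow s n ∨
      ∃ y ∈ swapsBelow s n, ∃ z' ∈ swapsBelow s n, s n * z * s n = y * s n * z' := by
  induction n with
  | zero =>
    intro z hz
    have e : s '' Set.Iio 0 = ∅ := by simp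
    rw [swapsBelow, e, Subgroup.closure_empty, Subgroup.mem_bot] at hz
    subst hz
    exact Or.inl (by rw [mul_one, h.swap_mul_self]; exact one_mem _)
  | succ n ih =>
    intro z hz
    have mono := swapsBelow_mono s (Nat.le_succ n)
    rcases h.mem_swapsBelow_succ_of_conj ih hz with hz' | ⟨x, hx, y, hy, rfl⟩
    · refine Or.inl ?_
      rw [(h.commute_swapsBelow hz').eq, mul_assoc, h.swap_mul_self, mul_one]
      exact hz
    · have hs : s n ∈ swapsBelow s (n + 1) :=
        Subgroup.subset_closure ⟨n, Nat.lt_succ_self n, rfl⟩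
      refine Or.inr ⟨x * s n, mul_mem (mono hx) hs, s n * y, mul_mem hs (mono hy), ?_⟩
      calc s (n + 1) * (x * s n * y) * s (n + 1)
          = (s (n + 1) * x) * s n * (y * s (n + 1)) := by group
        _ = (x * s (n + 1)) * s n * (s (n + 1) * y) := by
          rw [(h.commute_swapsBelow hx).eq, (h.commute_swapsBelow hy).eq]
        _ = x * (s (n + 1) * s n * s (n + 1)) * y := by group
        _ = x * (s n * s (n + 1) * s n) * y := by rw [h.braid]
        _ = _ := by group

theorem mem_swapsBelow_succ (h : CombRelations a s) {n : ℕ} {x : G}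
    (hx : x ∈ swapsBelow s (n + 1)) :
    x ∈ swapsBelow s n ∨ ∃ y ∈ swapsBelow s n, ∃ z ∈ swapsBelow s n, x = y * s n * z :=
  h.mem_swapsBelow_succ_of_conj (h.conj_mem_swapsBelow n) hx

theorem exists_mem_swapsBelow {x : G} (hx : x ∈ swaps s) : ∃ n, x ∈ swapsBelow s n := by
  induction hx using Subgroup.closure_induction with
  | mem x hx =>
    obtain ⟨i, rfl⟩ := hx
    exact ⟨i + 1, Subgroup.subset_closure ⟨i, Nat.lt_succ_self i, rfl⟩⟩
  | one => exact ⟨0, one_mem _⟩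
  | mul x y _ _ hx hy =>
    obtain ⟨m, hm⟩ := hx
    obtain ⟨n, hn⟩ := hy
    exact ⟨max m n, mul_mem (swapsBelow_mono s (le_max_left m n) hm)
      (swapsBelow_mono s (le_max_right m n) hn)⟩
  | inv x _ hx =>
    obtain ⟨n, hn⟩ := hx
    exact ⟨n, inv_mem hn⟩

/-! ### Faithfulness of the action on paths -/

/-- The path `1ⁱx`. -/
def spine : ℕ → Path → Path
  | 0, x => x
  | i + 1, x => cons true (spine i x)

theorem spine_injective (i : ℕ) : Function.Injective (spine i) := by
  induction i with
  | zero => exact fun _ _ h => h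
  | succ i ih => exact fun _ _ h => ih (congrArg Stream'.tail h)

theorem spine_spine (i j : ℕ) (x : Path) : spine i (spine j x) = spine (i + j) x := by
  induction i with
  | zero => rw [zero_add]; rfl
  | succ i ih => rw [Nat.succ_add, spine, spine, ih]

theorem below_replicate_spine (i : ℕ) (p : Equiv.Perm Path) (x : Path) :
    below (List.replicate i true) p (spine i x) = spine i (p x) := by
  induction i with
  | zero => rfl
  | succ i ih => simp [List.replicate_succ, spine, ih]

theorem below_replicate_spine_of_lt {i j : ℕ} (hij : i < j) (p : Equiv.Perm Path) (x : Path) :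
    below (List.replicate j true) p (spine i (cons false x)) = spine i (cons false x) := by
  induction i generalizing j with
  | zero =>
    obtain ⟨j, rfl⟩ := Nat.exists_eq_succ_of_ne_zero hij.ne'
    simp [List.replicate_succ, spine]
  | succ i ih =>
    obtain ⟨j, rfl⟩ := Nat.exists_eq_succ_of_ne_zero (Nat.ne_zero_of_lt hij)
    simp [List.replicate_succ, spine, ih (Nat.lt_of_succ_lt_succ hij)]

/-- `p` moves the cones below the vertices `1ⁱ0` as the permutation `τ` of `ℕ` does. -/
def MovesLeaves (p : Equiv.Perm Path) (τ : Equiv.Perm ℕ) : Prop :=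
  ∀ i x, p (spine i (cons false x)) = spine (τ i) (cons false x)

theorem MovesLeaves.one : MovesLeaves 1 1 := fun _ _ => rfl

theorem MovesLeaves.mul {p q : Equiv.Perm Path} {τ ρ : Equiv.Perm ℕ} (hp : MovesLeaves p τ)
    (hq : MovesLeaves q ρ) : MovesLeaves (p * q) (τ * ρ) := fun i x => by
  rw [Equiv.Perm.mul_apply, hq, hp, Equiv.Perm.mul_apply]

theorem MovesLeaves.inv {p : Equiv.Perm Path} {τ : Equiv.Perm ℕ} (hp : MovesLeaves p τ) :
    MovesLeaves p⁻¹ τ⁻¹ := fun i x => by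
  rw [Equiv.Perm.inv_eq_iff_eq, hp]; simp

theorem movesLeaves_permS (i : ℕ) :
    MovesLeaves (below (List.replicate i true) permS) (Equiv.swap i (i + 1)) := by
  intro j x
  rcases lt_or_ge j i with hj | hj
  · rw [below_replicate_spine_of_lt hj, Equiv.swap_apply_of_ne_of_ne hj.ne (by omega)]
  · obtain ⟨k, rfl⟩ := Nat.exists_eq_add_of_le hj
    rw [← spine_spine, below_replicate_spine]
    match k with
    | 0 =>
      rw [add_zero, Equiv.swap_apply_left, spine, permS_false, ← spine_spine i 1]
      rfl
    | 1 =>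
      rw [Equiv.swap_apply_right, spine, spine, permS_true_false]
    | k + 2 =>
      rw [Equiv.swap_apply_of_ne_of_ne (by omega) (by omega), spine, spine, permS_true_true,
        ← spine_spine]
      rfl

/-! ### Order-preserving permutations of paths -/

/-- The lexicographic order on paths. -/
def PathLT (x y : Path) : Prop :=
  ∃ n, (∀ m < n, x.get m = y.get m) ∧ x.get n = false ∧ y.get n = true

theorem pathLT_false_true (x y : Path) : PathLT (cons false x) (cons true y) :=
  ⟨0, by simp, rfl, rfl⟩

theorem not_pathLT_true_false (x y : Path) : ¬ PathLT (cons true x) (cons false y) := by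
  rintro ⟨_ | n, h, h1, h2⟩
  · exact absurd h1 (by simp)
  · exact absurd (h 0 n.succ_pos) (by simp)

theorem pathLT_cons (b : Bool) (x y : Path) : PathLT (cons b x) (cons b y) ↔ PathLT x y := by
  constructor
  · rintro ⟨_ | n, h, h1, h2⟩
    · rw [Stream'.get_zero_cons] at h1 h2
      exact absurd (h1.symm.trans h2) (by simp)
    · exact ⟨n, fun m hm => h (m + 1) (by omega), h1, h2⟩
  · rintro ⟨n, h, h1, h2⟩
    refine ⟨n + 1, ?_, h1, h2⟩
    rintro (_ | m) hm
    · rfl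
    · exact h m (by omega)

/-- The order-preserving permutations of paths. -/
def monotonePerms : Subgroup (Equiv.Perm Path) where
  carrier := {p | ∀ x y, PathLT (p x) (p y) ↔ PathLT x y}
  mul_mem' hp hq x y := (hp _ _).trans (hq x y)
  one_mem' _ _ := Iff.rfl
  inv_mem' {p} hp x y := by rw [← hp]; simp

theorem permA_mem_monotonePerms : permA ∈ monotonePerms := by
  intro x y
  obtain ⟨b, x, rfl⟩ := exists_cons x
  obtain ⟨c, x, rfl⟩ := exists_cons x
  obtain ⟨d, y, rfl⟩ := exists_cons y
  obtain ⟨e, y, rfl⟩ := exists_cons y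
  cases b <;> cases c <;> cases d <;> cases e <;>
    simp [pathLT_cons, pathLT_false_true, not_pathLT_true_false]

theorem below_mem_monotonePerms {p : Equiv.Perm Path} (hp : p ∈ monotonePerms) (α : Address) :
    below α p ∈ monotonePerms := by
  induction α with
  | nil => exact hp
  | cons b α ih =>
    intro x y
    obtain ⟨c, x, rfl⟩ := exists_cons x
    obtain ⟨d, y, rfl⟩ := exists_cons y
    cases b <;> cases c <;> cases d <;>
      simp [pathLT_cons, pathLT_false_true, not_pathLT_true_false, ih x y]

/-- The inequality is only weak, as both paths may lie in the same cone. -/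
theorem pathLT_spine {i j : ℕ} (x y : Path) :
    PathLT (spine i (cons false x)) (spine j (cons false y)) → i ≤ j := by
  induction i generalizing j with
  | zero => simp
  | succ i ih =>
    rcases j with _ | j
    · exact fun h => absurd h (not_pathLT_true_false _ _)
    · exact fun h => Nat.succ_le_succ (ih ((pathLT_cons _ _ _).1 h))

theorem pathLT_spine_of_lt {i j : ℕ} (hij : i < j) (x y : Path) :
    PathLT (spine i (cons false x)) (spine j (cons false y)) := by
  induction i generalizing j with
  | zero =>
    obtain ⟨j, rfl⟩ := Nat.exists_eq_succ_of_ne_zero hij.ne'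
    exact pathLT_false_true _ _
  | succ i ih =>
    obtain ⟨j, rfl⟩ := Nat.exists_eq_succ_of_ne_zero (Nat.ne_zero_of_lt hij)
    exact (pathLT_cons _ _ _).2 (ih (Nat.lt_of_succ_lt_succ hij))

/-- The cones below 1ⁱ0 are ordered by i, so `τ` and `τ⁻¹` are both strictly increasing on ℕ, and
each then dominates the identity. -/
theorem MovesLeaves.eq_one_of_monotone {p : Equiv.Perm Path} {τ : Equiv.Perm ℕ}
    (hp : MovesLeaves p τ) (hm : p ∈ monotonePerms) : τ = 1 := by
  have strict : ∀ {p τ}, MovesLeaves p τ → p ∈ monotonePerms → StrictMono τ := by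
    intro p τ hp hm i j hij
    have x : Path := Stream'.const false
    have h := (hm _ _).2 (pathLT_spine_of_lt hij x x)
    rw [hp, hp] at h
    exact (pathLT_spine x x h).lt_of_ne fun e => hij.ne (τ.injective e)
  ext i
  have h1 := (strict hp hm).le_apply (x := i)
  have h2 := (strict hp.inv (inv_mem hm)).le_apply (x := τ i)
  replace h2 : τ i ≤ i := by simpa using h2
  exact le_antisymm h2 h1

/-! ### Faithfulness on the group generated by the swaps -/

variable {Φ : G →* Equiv.Perm Path}

/-- The swaps with index below `n` touch only the leaves 0, …, n. The fixed leaf `n + 1` is what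
tells the double coset of `s n` from the identity. -/
theorem exists_movesLeaves (hs : ∀ i, Φ (s i) = below (List.replicate i true) permS) {n : ℕ}
    {x : G} (hx : x ∈ swapsBelow s n) : ∃ τ, MovesLeaves (Φ x) τ ∧ τ (n + 1) = n + 1 := by
  induction hx using Subgroup.closure_induction with
  | mem x hx =>
    obtain ⟨i, hi, rfl⟩ := hx
    have hi : i < n := hi
    exact ⟨_, hs i ▸ movesLeaves_permS i, Equiv.swap_apply_of_ne_of_ne (by omega) (by omega)⟩
  | one => exact ⟨1, by rw [map_one]; exact .one, rfl⟩
  | mul x y _ _ hx hy =>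
    obtain ⟨τ, h1, h2⟩ := hx
    obtain ⟨ρ, h3, h4⟩ := hy
    exact ⟨τ * ρ, by rw [map_mul]; exact h1.mul h3, by rw [Equiv.Perm.mul_apply, h4, h2]⟩
  | inv x _ hx =>
    obtain ⟨τ, h1, h2⟩ := hx
    exact ⟨τ⁻¹, by rw [map_inv]; exact h1.inv, by rw [Equiv.Perm.inv_eq_iff_eq, h2]⟩

/-- Descent on `n`: if x = y s_n z with y, z in the smaller subgroup, the leaf permutation τ ∘ (n
n+1) ∘ ρ is trivial by monotonicity. Since τ and ρ fix n + 1, evaluating there gives τ(n) = n + 1 =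
τ(n + 1), which is absurd. -/
theorem eq_one_of_monotone (h : CombRelations a s)
    (hs : ∀ i, Φ (s i) = below (List.replicate i true) permS) {x : G} (hx : x ∈ swaps s)
    (hm : Φ x ∈ monotonePerms) : x = 1 := by
  obtain ⟨n, hn⟩ := exists_mem_swapsBelow hx
  induction n with
  | zero =>
    have e : s '' Set.Iio 0 = ∅ := by simp
    rwa [swapsBelow, e, Subgroup.closure_empty, Subgroup.mem_bot] at hn
  | succ n ih =>
    rcases h.mem_swapsBelow_succ hn with hn | ⟨y, hy, z, hz, rfl⟩
    · exact ih hn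
    · obtain ⟨τ, h1, h2⟩ := exists_movesLeaves hs hy
      obtain ⟨ρ, h3, h4⟩ := exists_movesLeaves hs hz
      have hsn : MovesLeaves (Φ (s n)) (Equiv.swap n (n + 1)) := hs n ▸ movesLeaves_permS n
      have key : τ * Equiv.swap n (n + 1) * ρ = 1 := by
        refine MovesLeaves.eq_one_of_monotone ?_ hm
        rw [map_mul, map_mul]
        exact (h1.mul hsn).mul h3
      have e := DFunLike.congr_fun key (n + 1)
      rw [Equiv.Perm.mul_apply, Equiv.Perm.mul_apply, h4, Equiv.swap_apply_right,
        Equiv.Perm.one_apply, ← h2] at e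
      have := τ.injective e
      omega

theorem merges_le_monotone (ha : ∀ i, Φ (a i) = below (List.replicate i true) permA) {f : G}
    (hf : f ∈ merges a) : Φ f ∈ monotonePerms := by
  induction hf using Submonoid.closure_induction with
  | mem x hx =>
    obtain ⟨i, rfl⟩ := hx
    rw [ha]
    exact below_mem_monotonePerms permA_mem_monotonePerms _
  | one => rw [map_one]; exact one_mem _
  | mul x y _ _ hx hy => rw [map_mul]; exact mul_mem hx hy

/-! ### The action separates sorted products of merges -/

/-- The path `0ᵏx`. -/
def leftSpine : ℕ → Path → Path
  | 0, x => x
  | i + 1, x => cons false (leftSpine i x)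

/-- Take for `c` the number of occurrences of `i` in `l`: each strips one 0 after 1ⁱ, while merges
of larger index fix the cone below 1ⁱ0. -/
theorem exists_action_mergeProd (ha : ∀ i, Φ (a i) = below (List.replicate i true) permA)
    (i : ℕ) (l : List ℕ) (hl : ∀ k ∈ l, i ≤ k) : ∃ c, ∀ x,
      Φ (mergeProd a l) (spine i (leftSpine c (cons false x))) = spine i (cons false x) := by
  induction l with
  | nil => exact ⟨0, fun x => by rw [mergeProd, map_one]; rfl⟩
  | cons k l ih =>
    obtain ⟨c, hc⟩ := ih fun k hk => hl k (by simp [hk])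
    rcases (hl k (by simp)).eq_or_lt with rfl | hk
    · refine ⟨c + 1, fun x => ?_⟩
      have e : ∃ y, leftSpine c (cons false x) = cons false y := by
        cases c <;> exact ⟨_, rfl⟩
      obtain ⟨y, hy⟩ := e
      rw [mergeProd, map_mul, Equiv.Perm.mul_apply, ha, below_replicate_spine, leftSpine, hy,
        permA_false_false, ← hy, hc]
    · refine ⟨c, fun x => ?_⟩
      have e : ∃ y, leftSpine c (cons false x) = cons false y := by
        cases c <;> exact ⟨_, rfl⟩
      obtain ⟨y, hy⟩ := e
      rw [mergeProd, map_mul, Equiv.Perm.mul_apply, ha, hy, below_replicate_spine_of_lt hk, ← hy,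
        hc]

theorem action_mergeProd_of_lt (ha : ∀ i, Φ (a i) = below (List.replicate i true) permA)
    (i : ℕ) (l : List ℕ) (hl : ∀ k ∈ l, i < k) (x : Path) :
    Φ (mergeProd a l) (spine i (cons false x)) = spine i (cons false x) := by
  induction l with
  | nil => rw [mergeProd, map_one]; rfl
  | cons k l ih =>
    rw [mergeProd, map_mul, Equiv.Perm.mul_apply, ha,
      below_replicate_spine_of_lt (hl k (by simp)), ih fun k hk => hl k (by simp [hk])]

/-- Below 1ⁱ0 the left product deletes at least one letter 0, whereas the right one acts trivially
there. -/
theorem action_mergeProd_ne (ha : ∀ i, Φ (a i) = below (List.replicate i true) permA)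
    {i : ℕ} {l m : List ℕ} (hl : ∀ k ∈ l, i ≤ k) (hm : ∀ k ∈ m, i < k) :
    Φ (mergeProd a (i :: l)) ≠ Φ (mergeProd a m) := by
  intro e
  obtain ⟨c, hc⟩ := exists_action_mergeProd ha i l hl
  have hx : ∀ x, ∃ y, leftSpine c (cons false x) = cons false y := fun x => by
    cases c <;> exact ⟨_, rfl⟩
  -- Equality of the actions would give 0ᶜ0x = x, so `x` must not start with 0.
  set x : Path := Stream'.const true
  obtain ⟨y, hy⟩ := hx x
  have h1 : Φ (mergeProd a (i :: l)) (spine i (leftSpine (c + 1) (cons false x))) =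
      spine i (cons false x) := by
    rw [mergeProd, map_mul, Equiv.Perm.mul_apply, ha, below_replicate_spine, leftSpine, hy,
        permA_false_false, ← hy, hc]
  rw [e, leftSpine, action_mergeProd_of_lt ha i m hm] at h1
  have h2 := congrArg Stream'.tail (spine_injective i h1)
  rw [Stream'.tail_cons, Stream'.tail_cons, hy] at h2
  have h3 : (cons false y).head = x.head := congrArg Stream'.head h2
  exact absurd h3 (by simp [x, Stream'.head])

/-- The head of a sorted list is its least index. Different heads are separated by
`action_mergeProd_ne`; equal heads are the last factors and cancel. -/
theorem mergeProd_injOn (ha : ∀ i, Φ (a i) = below (List.replicate i true) permA) :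
    ∀ {l m : List ℕ}, l.Pairwise (· ≤ ·) → m.Pairwise (· ≤ ·) →
      Φ (mergeProd a l) = Φ (mergeProd a m) → l = m := by
  intro l
  induction l with
  | nil =>
    intro m _ hm e
    rcases m with _ | ⟨j, m⟩
    · rfl
    · exact absurd e.symm (action_mergeProd_ne ha (List.pairwise_cons.1 hm).1 (by simp))
  | cons i l ih =>
    intro m hl hm e
    rw [List.pairwise_cons] at hl
    rcases m with _ | ⟨j, m⟩
    · exact absurd e (action_mergeProd_ne ha hl.1 (by simp))
    · rw [List.pairwise_cons] at hm
      rcases lt_trichotomy i j with hij | rfl | hij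
      · refine absurd e (action_mergeProd_ne ha hl.1 fun k hk => ?_)
        rcases List.mem_cons.1 hk with rfl | hk
        · exact hij
        · exact hij.trans_le (hm.1 k hk)
      · rw [mergeProd, mergeProd, map_mul, map_mul, mul_left_inj] at e
        rw [ih hl.2 hm.2 e]
      · refine absurd e.symm (action_mergeProd_ne ha hm.1 fun k hk => ?_)
        rcases List.mem_cons.1 hk with rfl | hk
        · exact hij
        · exact hij.trans_le (hl.1 k hk)

theorem eq_one_of_action_eq_one (h : CombRelations a s)
    (ha : ∀ i, Φ (a i) = below (List.replicate i true) permA)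
    (hs : ∀ i, Φ (s i) = below (List.replicate i true) permS) {x : G}
    (hx : x ∈ Subgroup.closure (Set.range a ∪ Set.range s)) (hΦ : Φ x = 1) : x = 1 := by
  obtain ⟨f, hf, σ, hσ, g, hg, rfl⟩ := h.exists_fraction hx
  have e : Φ σ = Φ f * (Φ g)⁻¹ := by
    rw [map_mul, map_mul, map_inv, mul_assoc, inv_mul_eq_one] at hΦ
    rw [eq_mul_inv_iff_mul_eq, ← hΦ]
  -- By `e`, `σ` acts as a quotient of order-preserving permutations.
  obtain rfl : σ = 1 := h.eq_one_of_monotone hs hσ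
    (e ▸ mul_mem (merges_le_monotone ha hf) (inv_mem (merges_le_monotone ha hg)))
  obtain ⟨l, hl, rfl⟩ := h.exists_sorted hf
  obtain ⟨m, hm, rfl⟩ := h.exists_sorted hg
  rw [map_one, eq_comm, mul_inv_eq_one] at e
  rw [mergeProd_injOn ha hl hm e, mul_one, inv_mul_cancel]

end CombRelations

/-! ### The presented group -/

/-- The group presented by `R_AS` and the torsion relations. -/
abbrev Pres : Type := PresentedGroup (relAS ∪ relTorsion)

/-- The generator `X_α` of the presented group. -/
def gen (X : Kind) (α : Address) : Pres := PresentedGroup.of (X, α)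

theorem mk_ltr (X : Kind) (α : Address) :
    PresentedGroup.mk (relAS ∪ relTorsion) (ltr X α) = gen X α := rfl

theorem mk_shiftWord_eq (γ : Address) {u v : FreeGroup (Kind × Address)} (h : BaseRel u v) :
    PresentedGroup.mk (relAS ∪ relTorsion) (shiftWord γ u) =
      PresentedGroup.mk (relAS ∪ relTorsion) (shiftWord γ v) := by
  rw [← mul_inv_eq_one, ← map_inv, ← map_mul]
  exact PresentedGroup.one_of_mem (Or.inl ⟨γ, u, v, h, rfl⟩)

theorem shiftWord_ltr (γ : Address) (X : Kind) (α : Address) :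
    shiftWord γ (ltr X α) = ltr X (γ ++ α) := FreeGroup.map.of

theorem gen_S_mul_self (α : Address) : gen Kind.S α * gen Kind.S α = 1 := by
  rw [← pow_two, ← mk_ltr, ← map_pow]
  exact PresentedGroup.one_of_mem (Or.inr ⟨α, rfl⟩)

theorem gen_eq_of_baseRel₂ (γ : Address) {X Y Z W : Kind} {α β δ ε : Address}
    (h : BaseRel (ltr X α * ltr Y β) (ltr Z δ * ltr W ε)) :
    gen X (γ ++ α) * gen Y (γ ++ β) = gen Z (γ ++ δ) * gen W (γ ++ ε) := by
  have := mk_shiftWord_eq γ h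
  simpa only [map_mul, shiftWord_ltr, mk_ltr] using this

theorem gen_eq_of_baseRel₃₂ (γ : Address) {X Y Z W V : Kind} {α β δ ε ζ : Address}
    (h : BaseRel (ltr X α * ltr Y β * ltr V ζ) (ltr Z δ * ltr W ε)) :
    gen X (γ ++ α) * gen Y (γ ++ β) * gen V (γ ++ ζ) = gen Z (γ ++ δ) * gen W (γ ++ ε) := by
  have := mk_shiftWord_eq γ h
  simpa only [map_mul, shiftWord_ltr, mk_ltr] using this

theorem gen_eq_of_baseRel₂₃ (γ : Address) {X Y Z W V : Kind} {α β δ ε ζ : Address}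
    (h : BaseRel (ltr X α * ltr Y β) (ltr Z δ * ltr W ε * ltr V ζ)) :
    gen X (γ ++ α) * gen Y (γ ++ β) = gen Z (γ ++ δ) * gen W (γ ++ ε) * gen V (γ ++ ζ) := by
  have := mk_shiftWord_eq γ h
  simpa only [map_mul, shiftWord_ltr, mk_ltr] using this

theorem gen_eq_of_baseRel₃ (γ : Address) {X Y Z W V U : Kind} {α β δ ε ζ η : Address}
    (h : BaseRel (ltr X α * ltr Y β * ltr V ζ) (ltr Z δ * ltr W ε * ltr U η)) :
    gen X (γ ++ α) * gen Y (γ ++ β) * gen V (γ ++ ζ) =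
      gen Z (γ ++ δ) * gen W (γ ++ ε) * gen U (γ ++ η) := by
  have := mk_shiftWord_eq γ h
  simpa only [map_mul, shiftWord_ltr, mk_ltr] using this

/-! ### The comb relations in the presented group -/

/-- The address `1ⁱ`. -/
abbrev ones (i : ℕ) : Address := List.replicate i true

theorem ones_append (i j : ℕ) : ones i ++ ones j = ones (i + j) := List.replicate_append_replicate

theorem ones_append_nil (i : ℕ) : ones i ++ [] = ones i := List.append_nil _

theorem ones_append_singleton (i : ℕ) : ones i ++ [true] = ones (i + 1) := ones_append i 1

theorem gen_A_ones_of_lt (X : Kind) {i j : ℕ} (hij : i < j) :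
    gen X (ones (j + 1)) * gen Kind.A (ones i) = gen Kind.A (ones i) * gen X (ones j) := by
  obtain ⟨k, rfl⟩ := Nat.exists_eq_add_of_lt hij
  have := gen_eq_of_baseRel₂ (ones i) (.geomA11 X (ones k))
  rw [ones_append_nil, show true :: true :: ones k = ones (k + 2) from rfl,
    show true :: ones k = ones (k + 1) from rfl, ones_append, ones_append] at this
  exact this

theorem gen_S_ones_of_le (X : Kind) {i j : ℕ} (hij : i + 2 ≤ j) :
    gen X (ones j) * gen Kind.S (ones i) = gen Kind.S (ones i) * gen X (ones j) := by
  obtain ⟨k, rfl⟩ := Nat.exists_eq_add_of_le hij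
  have := gen_eq_of_baseRel₂ (ones i) (.geomS11 X (ones k))
  rw [ones_append_nil, show true :: true :: ones k = ones (k + 2) from rfl, ones_append,
    show i + (k + 2) = i + 2 + k by omega] at this
  exact this

theorem combRelations_gen :
    CombRelations (fun i => gen Kind.A (ones i)) (fun i => gen Kind.S (ones i)) where
  merge_merge _ _ := gen_A_ones_of_lt Kind.A
  swap_merge _ _ := gen_A_ones_of_lt Kind.S
  merge_swap _ _ := gen_S_ones_of_le Kind.A
  swap_swap _ _ := gen_S_ones_of_le Kind.S
  merge_swap_self i := by
    have := gen_eq_of_baseRel₃₂ (ones i) .mixed2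
    rwa [ones_append_nil, ones_append_singleton] at this
  merge_swap_succ i := by
    have := gen_eq_of_baseRel₃₂ (ones i) .mixed3
    rwa [ones_append_nil, ones_append_singleton] at this
  braid i := by
    have := gen_eq_of_baseRel₃ (ones i) .braid
    rwa [ones_append_nil, ones_append_singleton] at this
  swap_mul_self i := gen_S_mul_self _

/-! ### Generation by the letters on the right spine -/

/-- The subgroup generated by the letters with an address `1ⁱ`. -/
abbrev onesSubgroup : Subgroup Pres := Subgroup.closure
  (Set.range (fun i => gen Kind.A (ones i)) ∪ Set.range (fun i => gen Kind.S (ones i)))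

theorem gen_ones_mem : ∀ (X : Kind) (i : ℕ), gen X (ones i) ∈ onesSubgroup
  | Kind.A, i => Subgroup.subset_closure (Or.inl ⟨i, rfl⟩)
  | Kind.S, i => Subgroup.subset_closure (Or.inr ⟨i, rfl⟩)

/-- The pentagon and `mixed1` contain the address 0 once, as the last factor, so they can be solved
for that letter. -/
theorem gen_ones_false_mem (X : Kind) (i : ℕ) : gen X (ones i ++ [false]) ∈ onesSubgroup := by
  have hA := gen_ones_mem Kind.A i
  have hA' := gen_ones_mem Kind.A (i + 1)
  cases X
  · have := gen_eq_of_baseRel₂₃ (ones i) .pentagon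
    rw [ones_append_nil, ones_append_singleton] at this
    rw [← Subgroup.mul_mem_cancel_left _ (mul_mem hA' hA), ← this]
    exact mul_mem hA hA
  · have := gen_eq_of_baseRel₃ (ones i) .mixed1
    rw [ones_append_nil, ones_append_singleton] at this
    rw [← Subgroup.mul_mem_cancel_left _ (mul_mem hA' hA), ← this]
    exact mul_mem (mul_mem (gen_ones_mem Kind.S i) hA') hA

/-- Conjugation by A_{1ⁱ} turns X_{1ⁱ0α} into X_{1ⁱ00α} and X_{1ⁱ10α} into X_{1ⁱ01α}. The second
case calls the induction hypothesis at `i + 1`, hence the quantifier over `i` inside the induction.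
-/
theorem gen_ones_false_append_mem (X : Kind) (α : Address) :
    ∀ i, gen X (ones i ++ false :: α) ∈ onesSubgroup := by
  induction α with
  | nil => exact gen_ones_false_mem X
  | cons b α ih =>
    intro i
    have hA := gen_ones_mem Kind.A i
    cases b
    · have := gen_eq_of_baseRel₂ (ones i) (.geomA0 X α)
      rw [ones_append_nil] at this
      rw [← Subgroup.mul_mem_cancel_left _ hA, ← this]
      exact mul_mem (ih i) hA
    · have := gen_eq_of_baseRel₂ (ones i) (.geomA10 X α)
      rw [ones_append_nil, List.append_cons _ true, ones_append_singleton] at this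
      rw [← Subgroup.mul_mem_cancel_left _ hA, ← this]
      exact mul_mem (ih (i + 1)) hA

theorem exists_ones_append (α : Address) :
    ∃ i, α = ones i ∨ ∃ β, α = ones i ++ false :: β := by
  induction α with
  | nil => exact ⟨0, Or.inl rfl⟩
  | cons b α ih =>
    cases b
    · exact ⟨0, Or.inr ⟨α, rfl⟩⟩
    · obtain ⟨i, rfl | ⟨β, rfl⟩⟩ := ih
      · exact ⟨i + 1, Or.inl rfl⟩
      · exact ⟨i + 1, Or.inr ⟨β, rfl⟩⟩

theorem onesSubgroup_eq_top : onesSubgroup = ⊤ := by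
  rw [eq_top_iff, ← PresentedGroup.closure_range_of, Subgroup.closure_le]
  rintro _ ⟨⟨X, α⟩, rfl⟩
  obtain ⟨i, rfl | ⟨β, rfl⟩⟩ := exists_ones_append α
  · exact gen_ones_mem X i
  · exact gen_ones_false_append_mem X β i

/-! ### The isomorphism onto the subgroup -/

/-- The homomorphism from the presented group to the geometry group. -/
def presToGeometry : Pres →* GeometryGroup :=
  -- Relators are checked on paths, which suffices because the action is faithful.
  PresentedGroup.toGroup (f := fun x => el x.1 x.2) fun r hr => action_injective <| by
    have : action.comp (FreeGroup.lift fun x : Kind × Address => el x.1 x.2) = wordAction := by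
      ext1 x
      simp [wordAction, action_el]
    rw [map_one, ← wordAction_eq_one hr, ← this]
    rfl

theorem presToGeometry_gen (X : Kind) (α : Address) : presToGeometry (gen X α) = el X α :=
  PresentedGroup.toGroup.of _

theorem presToGeometry_injective : Function.Injective presToGeometry := by
  rw [injective_iff_map_eq_one]
  intro x hx
  refine combRelations_gen.eq_one_of_action_eq_one (Φ := action.comp presToGeometry)
    (fun i => ?_) (fun i => ?_) (onesSubgroup_eq_top.ge (Subgroup.mem_top x)) ?_
  · rw [MonoidHom.comp_apply, presToGeometry_gen, action_el]; rfl
  · rw [MonoidHom.comp_apply, presToGeometry_gen, action_el]; rfl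
  · rw [MonoidHom.comp_apply, hx, map_one]

theorem presToGeometry_range : presToGeometry.range = SBullet := by
  rw [MonoidHom.range_eq_map, ← PresentedGroup.closure_range_of, MonoidHom.map_closure, SBullet]
  congr 1
  ext g
  constructor
  · rintro ⟨_, ⟨⟨X, α⟩, rfl⟩, rfl⟩
    exact ⟨X, α, presToGeometry_gen X α⟩
  · rintro ⟨X, α, rfl⟩
    exact ⟨_, ⟨(X, α), rfl⟩, presToGeometry_gen X α⟩

end TreeGeometry

theorem proposition4p4 :
    ∃ e : PresentedGroup (TreeGeometry.relAS ∪ TreeGeometry.relTorsion) ≃* TreeGeometry.SBullet,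
      ∀ (X : TreeGeometry.Kind) (α : TreeGeometry.Address),
        ((e (PresentedGroup.of (X, α)) : TreeGeometry.SBullet) : TreeGeometry.GeometryGroup) =
          TreeGeometry.el X α :=
  ⟨(MonoidHom.ofInjective TreeGeometry.presToGeometry_injective).trans
    (MulEquiv.subgroupCongr TreeGeometry.presToGeometry_range),
    fun X α => TreeGeometry.presToGeometry_gen X α⟩
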